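/- **Theorem.** Let $\Pi$ be an LCL problem and let $\mathbb{G}$ be a class of $\Pi$-colorable finite structured graphs such that $\mathsf{Rand}_{\Pi,\mathbb{G}}(n) = o(\log n)$ as $n\to\infty$. Let $\mathbf{G}$ be a Borel structured graph of finite maximum degree all of whose finite induced structured subgraphs are in $\mathbb{G}$. If $\mathsf{asi}(\mathbf G) < \infty$, then $\mathbf{G}$ has a Borel $\Pi$-coloring, i.e. a $\Pi$-coloring $f : V(\mathbf G)\to\mathbb{N}$ such that $f^{-1}(i)$ is Borel for every $i \in \mathbb{N}$. Here the following definitions are used; $\mathbb{N}$ contains $0$, and all graphs are simple and undirected. *Structured graphs.* A structured graph is a pair $\mathbf G=(G,\sigma)$ of a graph $G$ and a partial function $\sigma$ from the set $V(G)^{<\infty}=\bigsqcup_{k\in\mathbb{N}}V(G)^k$ of finite tuples of vertices to $\mathbb{N}$ such that the lengths of the tuples in its domain are bounded. Graphs are the special case in which $\sigma$ is nowhere defined. For $U\subseteq V(G)$, the induced structured subgraph $\mathbf G[U]$ is the induced subgraph $G[U]$ with $\sigma$ restricted to tuples from $U$. Isomorphisms preserve adjacency and the structure maps (including their domains). $\mathbf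 G$ is Borel if $V(G)$ is a standard Borel space, $\{(u,v): uv\in E(G)\}$ is Borel in $V(G)^2$, and $\sigma^{-1}(i)$ is Borel in $V(G)^{<\infty}$ for every $i\in\mathbb{N}$. Degrees, balls and $\mathsf{asi}$ of $\mathbf G$ are those of $G$. *LCL problems and LOCAL algorithms.* For a locally finite structured graph $\mathbf G$, a labeling $f:V(\mathbf G)\to\mathbb{N}$, a vertex $v$ and $R\in\mathbb{N}$, let $B(v,R)$ be the set of vertices joined to $v$ by a path of at most $R$ edges, and let $[\mathbf G,f,v]_R$ be the isomorphism type of the rooted labeled structured graph $(\mathbf G[B(v,R)], f|_{B(v,R)}, v)$; here isomorphisms also preserve the labels and the root. An LCL problem is a pair $\Pi=(R,\mathcal P)$ where $R\in\mathbb{N}$ and $\mathcal P$ maps isomorphism types of finite rooted labeled structured graphs to $\{0,1\}$. A $\Pi$-coloring of $\mathbf G$ is an $f:V(\mathbf G)\to\mathbb{N}$ with $\mathcal P([\mathbf G,f,v]_R)=1$ for all $v$; $\mathbf G$ is $\Pi$-colorable if it has one. A LOCAL algorithm $\mathcal A$ maps isomorphism types of finite rooted labeled structured graphs to $\mathbb{N}$;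 its output on $(\mathbf G,f)$ after time $T\in\mathbb{N}$ is the function $\mathcal A_T(\mathbf G,f)$, $v\mapsto\mathcal A([\mathbf G,f,v]_T)$. *Randomized complexity.* For $n\ge 1$, $\mathsf{Rand}_{\Pi,\mathbb{G}}(n)\in\mathbb{N}\cup\{\infty\}$ is the least $T\in\mathbb{N}$ for which there exist an integer $\ell\geq 1$ and a LOCAL algorithm $\mathcal A$ such that for every $n$-vertex $\mathbf H\in\mathbb{G}$, if $\theta:V(\mathbf H)\to\{0,\dots,\ell-1\}$ is chosen uniformly at random, then $\mathcal A_T(\mathbf H,\theta)$ is a $\Pi$-coloring of $\mathbf H$ with probability at least $1-1/n$; it is $\infty$ if there is no such $T$. In particular, $\mathsf{Rand}_{\Pi,\mathbb{G}}(n)=o(\log n)$ includes that it is finite for all large $n$. *Asymptotic separation index.* The separation index $\mathsf{si}(G)$ is the least $s\in\mathbb{N}$ for which there is a partition of $V(G)$ into Borel sets $U_0,\dots,U_s$ (possibly empty) such that all connected components of each $G[U_i]$ are finite, and $\infty$ if there is none. $G^R$ is the graph on $V(G)$ in which two distinct vertices are adjacent iff they are joined by a path of at most $R$ edges of $G$,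 and $\mathsf{asi}(G)=\sup_{R\in\mathbb{N}}\mathsf{si}(G^R)$. -/

import Mathlib

open Filter Asymptotics

universe u

namespace BorelLCL

/-! ### Graphs: balls, powers, component-finiteness, degrees -/

section Graphs

variable {V : Type u}

/-- The `R`-ball around `v`: all vertices reachable from `v` along at most `R` edges. -/
def ball (G : SimpleGraph V) (v : V) (R : ℕ) : Set V :=
  {u | ∃ p : G.Walk v u, p.length ≤ R}

/-- The power `G^R`: two distinct vertices are adjacent when they are joined by
at most `R` edges in `G`. -/
def power (G : SimpleGraph V) (R : ℕ) : SimpleGraph V where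
  Adj u v := u ≠ v ∧ ∃ p : G.Walk u v, p.length ≤ R
  symm := ⟨fun _ _ h => ⟨h.1.symm, h.2.imp' SimpleGraph.Walk.reverse fun p hp => by simpa using hp⟩⟩
  loopless := ⟨fun _ h => h.1 rfl⟩

/-- Every connected component is finite. -/
def ComponentFinite (G : SimpleGraph V) : Prop :=
  ∀ c : G.ConnectedComponent, c.supp.Finite

/-- Every vertex has finitely many neighbours. -/
def LocallyFinite (G : SimpleGraph V) : Prop :=
  ∀ v, (G.neighborSet v).Finite

/-- The degrees are bounded by one natural number. -/
def FiniteMaxDegree (G : SimpleGraph V) : Prop :=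
  ∃ Δ : ℕ, ∀ v, (G.neighborSet v).encard ≤ Δ

theorem locallyFinite_of_finite [Finite V] (G : SimpleGraph V) : LocallyFinite G :=
  fun _ => Set.toFinite _

theorem ball_finite {G : SimpleGraph V} (hG : LocallyFinite G) (v : V) (R : ℕ) :
    (ball G v R).Finite := by
  induction R generalizing v with
  | zero =>
    refine (Set.finite_singleton v).subset ?_
    rintro u ⟨p, hp⟩
    exact (SimpleGraph.Walk.eq_of_length_eq_zero (Nat.le_zero.mp hp)).symm
  | succ R ih =>
    refine ((Set.finite_singleton v).union ((hG v).biUnion fun w _ => ih w)).subset ?_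
    rintro u ⟨p, hp⟩
    cases p with
    | nil => exact Or.inl rfl
    | cons h q =>
      refine Or.inr (Set.mem_biUnion (x := _) h ⟨q, ?_⟩)
      simpa using hp

theorem mem_ball_self (G : SimpleGraph V) (v : V) (R : ℕ) : v ∈ ball G v R :=
  ⟨SimpleGraph.Walk.nil, Nat.zero_le _⟩

end Graphs

/-! ### Borel graphs and the asymptotic separation index -/

section BorelGraphs

variable {V : Type u} [MeasurableSpace V]

/-- The adjacency relation is a Borel subset of `V × V`. -/
def IsBorelGraph (G : SimpleGraph V) : Prop :=
  MeasurableSet {p : V × V | G.Adj p.1 p.2}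

/-- There is a partition of the vertex set into `s + 1` Borel sets, given as the fibres of `c`,
each of which induces a component-finite subgraph. -/
def HasSeparation (G : SimpleGraph V) (s : ℕ) : Prop :=
  ∃ c : V → Fin (s + 1), (∀ i, MeasurableSet (c ⁻¹' {i})) ∧
    ∀ i, ComponentFinite (G.induce (c ⁻¹' {i}))

/-- The separation index; it is `⊤` when there is no suitable partition. -/
noncomputable def si (G : SimpleGraph V) : ℕ∞ :=
  sInf {t : ℕ∞ | ∃ s : ℕ, t = s ∧ HasSeparation G s}

/-- The asymptotic separation index. -/
noncomputable def asi (G : SimpleGraph V) : ℕ∞ :=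
  ⨆ R : ℕ, si (power G R)

end BorelGraphs

/-! ### Structured graphs -/

/-- The set `V^{<∞}` of finite tuples, as a disjoint union of powers of `V`. It carries the
measurable structure of a disjoint union of products. -/
abbrev Tuples (V : Type u) : Type u := Σ k : ℕ, (Fin k → V)

/-- Apply a map to every entry of a tuple. -/
def Tuples.map {V W : Type u} (φ : V → W) (x : Tuples V) : Tuples W :=
  ⟨x.1, fun i => φ (x.2 i)⟩

/-- A graph with a structure map: a partial function from finite tuples of vertices to `ℕ`
(`none` means undefined) whose domain consists of tuples of bounded length. A plain graph is the
case of a nowhere defined structure map. -/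
structure StructuredGraph (V : Type u) where
  graph : SimpleGraph V
  str : Tuples V → Option ℕ
  bounded : ∃ ℓ : ℕ, ∀ x : Tuples V, str x ≠ none → x.1 ≤ ℓ

namespace StructuredGraph

variable {V : Type u}

/-- The induced structured subgraph, with the structure map restricted to tuples from `U`. -/
def induce (G : StructuredGraph V) (U : Set V) : StructuredGraph U where
  graph := G.graph.induce U
  str x := G.str (x.map Subtype.val)
  bounded := G.bounded.imp fun _ h x hx => h (x.map Subtype.val) hx

/-- A structured graph is Borel if its graph is Borel and the preimages of all values of the
structure map are Borel. -/
def IsBorel [MeasurableSpace V] (G : StructuredGraph V) : Prop :=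
  IsBorelGraph G.graph ∧ ∀ i : ℕ, MeasurableSet {x : Tuples V | G.str x = some i}

end StructuredGraph

/-- A finite structured graph. -/
structure FinStructuredGraph : Type (u + 1) where
  carrier : Type u
  finite : Finite carrier
  graph : StructuredGraph carrier

/-- The subgraph induced on a finite set of vertices, as a finite structured graph. -/
def StructuredGraph.finInduce {V : Type u} (G : StructuredGraph V) (U : Finset V) :
    FinStructuredGraph.{u} where
  carrier := (U : Set V)
  finite := U.finite_toSet
  graph := G.induce (U : Set V)

/-! ### Isomorphism types of rooted labeled graphs -/

/-- A finite rooted labeled structured graph. -/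
structure RootedLabeledGraph : Type (u + 1) where
  carrier : Type u
  finite : Finite carrier
  graph : StructuredGraph carrier
  label : carrier → ℕ
  root : carrier

/-- Isomorphism: a bijection that preserves adjacency, the structure map (with its domain), the
labels and the root. -/
def RootedLabeledGraph.Iso (X Y : RootedLabeledGraph.{u}) : Prop :=
  ∃ φ : X.carrier ≃ Y.carrier,
    (∀ a b, Y.graph.graph.Adj (φ a) (φ b) ↔ X.graph.graph.Adj a b) ∧
    (∀ x : Tuples X.carrier, Y.graph.str (x.map φ) = X.graph.str x) ∧
    (∀ a, Y.label (φ a) = X.label a) ∧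
    φ X.root = Y.root

instance RootedLabeledGraph.setoid : Setoid RootedLabeledGraph.{u} where
  r := RootedLabeledGraph.Iso
  iseqv :=
    { refl := fun X => ⟨Equiv.refl _, fun _ _ => Iff.rfl, fun _ => rfl, fun _ => rfl, rfl⟩
      symm := by
        rintro X Y ⟨φ, h1, h2, h3, h4⟩
        refine ⟨φ.symm, fun a b => ?_, fun x => ?_, fun a => ?_, ?_⟩
        · rw [← h1]; simp
        · rw [← h2]; simp [Tuples.map]
        · rw [← h3]; simp
        · rw [← h4]; simp
      trans := by
        rintro X Y Z ⟨φ, h1, h2, h3, h4⟩ ⟨ψ, k1, k2, k3, k4⟩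
        refine ⟨φ.trans ψ, fun a b => ?_, fun x => ?_, fun a => ?_, ?_⟩
        · rw [← h1, ← k1]; rfl
        · rw [← h2, ← k2]; rfl
        · rw [← h3, ← k3]; rfl
        · rw [← k4, ← h4]; rfl }

/-- Isomorphism types of finite rooted labeled structured graphs. -/
def IsoType : Type (u + 1) := Quotient RootedLabeledGraph.setoid.{u}

/-- `[G, f, v]_R`, the isomorphism type of the `R`-ball around `v` in a locally finite
labeled structured graph. -/
def ballType {V : Type u} (G : StructuredGraph V) (hG : LocallyFinite G.graph) (f : V → ℕ)
    (v : V) (R : ℕ) : IsoType.{u} :=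
  Quotient.mk RootedLabeledGraph.setoid
    { carrier := ball G.graph v R
      finite := ball_finite hG v R
      graph := G.induce (ball G.graph v R)
      label := fun u => f u
      root := ⟨v, mem_ball_self G.graph v R⟩ }

/-! ### LCL problems, LOCAL algorithms, randomized complexity -/

/-- A locally checkable labeling problem: a radius and a set of admissible isomorphism types. -/
structure LCLProblem : Type (u + 1) where
  radius : ℕ
  valid : IsoType.{u} → Prop

/-- `f` is a `Π`-coloring of the locally finite structured graph `G`. -/
def LCLProblem.IsColoring (P : LCLProblem.{u}) {V : Type u} (G : StructuredGraph V)
    (hG : LocallyFinite G.graph) (f : V → ℕ) : Prop :=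
  ∀ v, P.valid (ballType G hG f v P.radius)

/-- A LOCAL algorithm. -/
abbrev LocalAlgorithm : Type (u + 1) := IsoType.{u} → ℕ

/-- The output of a LOCAL algorithm on a locally finite labeled structured graph after time `T`. -/
def LocalAlgorithm.output (A : LocalAlgorithm.{u}) (T : ℕ) {V : Type u} (G : StructuredGraph V)
    (hG : LocallyFinite G.graph) (f : V → ℕ) : V → ℕ :=
  fun v => A (ballType G hG f v T)

namespace FinStructuredGraph

theorem locallyFinite (H : FinStructuredGraph.{u}) : LocallyFinite H.graph.graph :=
  haveI := H.finite
  locallyFinite_of_finite _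

/-- A finite structured graph that has a `Π`-coloring. -/
def IsColorable (H : FinStructuredGraph.{u}) (P : LCLProblem.{u}) : Prop :=
  ∃ f : H.carrier → ℕ, P.IsColoring H.graph H.locallyFinite f

/-- The probability that `A`, run for time `T` on `H` with a uniformly random labeling
`θ : V(H) → {0, …, ℓ - 1}`, outputs a `Π`-coloring. -/
noncomputable def successProb (H : FinStructuredGraph.{u}) (P : LCLProblem.{u})
    (A : LocalAlgorithm.{u}) (T ℓ : ℕ) : ℝ :=
  (Nat.card {θ : H.carrier → Fin ℓ //
      P.IsColoring H.graph H.locallyFinite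
        (A.output T H.graph H.locallyFinite fun v => (θ v : ℕ))} : ℝ) /
    (Nat.card (H.carrier → Fin ℓ) : ℝ)

end FinStructuredGraph

/-- Some LOCAL algorithm with random labels from a finite set solves `Π` in time `T` on all
`n`-vertex members of the class with probability at least `1 - 1/n`. -/
def RandSolvable (P : LCLProblem.{u}) (C : Set FinStructuredGraph.{u}) (n T : ℕ) : Prop :=
  ∃ ℓ : ℕ, 0 < ℓ ∧ ∃ A : LocalAlgorithm.{u},
    ∀ H ∈ C, Nat.card H.carrier = n → 1 - 1 / (n : ℝ) ≤ H.successProb P A T ℓ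

/-- The randomized LOCAL complexity of `Π` on a class of finite structured graphs (only its values
at `n ≥ 1` are meaningful). -/
noncomputable def randComplexity (P : LCLProblem.{u}) (C : Set FinStructuredGraph.{u}) (n : ℕ) :
    ℕ∞ :=
  sInf {t : ℕ∞ | ∃ T : ℕ, t = T ∧ RandSolvable P C n T}

/-- A function with values in `ℕ ∪ {∞}` is `o(log n)`: it is eventually finite, and its
finite values are `o(log n)`. -/
def IsLittleOLog (t : ℕ → ℕ∞) : Prop :=
  (∀ᶠ n in atTop, t n ≠ ⊤) ∧
    (fun n : ℕ => ((t n).toNat : ℝ)) =o[atTop] fun n : ℕ => Real.log n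

theorem FiniteMaxDegree.locallyFinite {V : Type u} {G : SimpleGraph V} (h : FiniteMaxDegree G) :
    LocallyFinite G := by
  obtain ⟨Δ, hΔ⟩ := h
  exact fun v => Set.finite_of_encard_le_coe (hΔ v)

end BorelLCL

open BorelLCL

set_option linter.unusedSectionVars false

/-! Run an algorithm meant for n-vertex graphs on `G` itself, for one well-chosen n. Let T be its
running time, R the radius of the problem, Δ a degree bound and M = (Δ+1)^(T+R). What happens at a
vertex v depends only on the ball of radius T+R, which has at most M vertices. If M ≤ n and `V` is
infinite, this ball lies in an n-vertex induced subgraph, where the algorithm fails with probability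
at most 1/n; so random labels on `G` violate the constraint at v with probability at most 1/n
(`resample_violates_le`). As T = o(log n), M is n^(o(1)), and 1/n beats any prescribed power of M
(`IsLittleOLog.exists_pow_lt`). It remains to find one Borel labeling that avoids all these events.

Finite asymptotic separation index gives a bound s independent of the radius: `V` splits into at
most s+1 Borel parts whose components at scale 2(T+R) are finite. Labels are fixed one part at a
time, keeping track of the conditional probability of each bad event given the labels fixed so far.
No event sees two components of the same part, so the components can be treated separately. On one
component, the new conditional probabilities average to the old ones. By Markov's inequality each of
them grows by a factor above 4M² with probability at most 1/(4M²), and the finite Local Lemma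
(`exists_avoiding`) yields labels for which none does (`exists_extension`). After all rounds the
conditional probabilities are below (4M²)^(s+1)/n < 1. As every label is then fixed, they are 0 or
1, hence 0 (`exists_measurable_avoiding`).

The choices are Borel because countably many Borel functions realize all labelings of finite sets:
each component takes the first of them that works (`exists_measurable_extension`). -/

namespace BorelLCL

/-! ### Averaging over finitely many coordinates and the Local Lemma -/

section Resample

/-- The average of `F` over all ways to resample the coordinates in `S` uniformly. -/
noncomputable def resample {V : Type*} {L : Type*} [DecidableEq V] [Fintype L] (S : Finset V)
    (F : (V → L) → ℝ) (θ : V → L) : ℝ :=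
  Finset.expect Finset.univ fun η : S → L => F (Function.updateFinset θ S η)

variable {V : Type*} {L : Type*} [DecidableEq V] [Fintype L]

theorem resample_mono {S : Finset V} {F F' : (V → L) → ℝ} (h : ∀ θ, F θ ≤ F' θ) (θ : V → L) :
    resample S F θ ≤ resample S F' θ :=
  Finset.expect_le_expect fun _ _ => h _

theorem resample_sub (S : Finset V) (F F' : (V → L) → ℝ) (θ : V → L) :
    resample S (fun θ => F θ - F' θ) θ = resample S F θ - resample S F' θ :=
  Finset.expect_sub_distrib _ _ _

theorem resample_sum {ι : Type*} (I : Finset ι) (S : Finset V) (F : ι → (V → L) → ℝ) (θ : V → L) :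
    resample S (fun θ => ∑ i ∈ I, F i θ) θ = ∑ i ∈ I, resample S (F i) θ :=
  Finset.expect_sum_comm _ _ _

theorem resample_div (S : Finset V) (F : (V → L) → ℝ) (a : ℝ) (θ : V → L) :
    resample S (fun θ => F θ / a) θ = resample S F θ / a :=
  (Finset.expect_div _ _ _).symm

theorem resample_congr {S : Finset V} {F F' : (V → L) → ℝ} {θ : V → L}
    (h : ∀ η, F (Function.updateFinset θ S η) = F' (Function.updateFinset θ S η)) :
    resample S F θ = resample S F' θ :=
  Finset.expect_congr rfl fun η _ => h η

theorem resample_nonneg {S : Finset V} {F : (V → L) → ℝ} (h : ∀ θ, 0 ≤ F θ) (θ : V → L) :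
    0 ≤ resample S F θ :=
  Finset.expect_nonneg fun _ _ => h _

theorem updateFinset_eq_of_notMem {S : Finset V} {θ : V → L} {η : S → L} {x : V} (hx : x ∉ S) :
    Function.updateFinset θ S η x = θ x := by
  simp [Function.updateFinset, hx]

theorem updateFinset_eq_of_mem {S : Finset V} {θ : V → L} {η : S → L} {x : V} (hx : x ∈ S) :
    Function.updateFinset θ S η x = η ⟨x, hx⟩ := by
  simp [Function.updateFinset, hx]

theorem exists_pos_of_resample_pos {S : Finset V} {F : (V → L) → ℝ} {θ : V → L}
    (h : 0 < resample S F θ) : ∃ θ' : V → L, (∀ x ∉ S, θ' x = θ x) ∧ 0 < F θ' := by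
  by_contra! hc
  exact absurd h (not_lt.2 ((Finset.expect_le_expect fun η _ =>
    hc _ fun x hx => updateFinset_eq_of_notMem hx).trans_eq (Finset.expect_const_zero _)))

theorem resample_eq_self [Nonempty L] {S : Finset V} {N : Set V} {F : (V → L) → ℝ}
    (hF : DependsOn F N) (h : Disjoint (S : Set V) N) (θ : V → L) : resample S F θ = F θ := by
  unfold resample
  rw [Finset.expect_congr rfl (g := fun _ => F θ), Fintype.expect_const]
  intro η _
  exact hF fun x hx => updateFinset_eq_of_notMem fun hxS => h.le_bot ⟨hxS, hx⟩

theorem resample_dependsOn {S : Finset V} {N : Set V} {F : (V → L) → ℝ}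
    (hF : DependsOn F N) : DependsOn (resample S F) (N \ S) := by
  intro θ θ' h
  refine Finset.expect_congr rfl fun η _ => hF fun x hx => ?_
  by_cases hxS : x ∈ S
  · simp [updateFinset_eq_of_mem hxS]
  · simp [updateFinset_eq_of_notMem hxS, h x ⟨hx, hxS⟩]

/-- Fubini for uniform labels; it serves as the law of total probability. -/
theorem resample_resample {S T : Finset V} (h : Disjoint S T)
    (F : (V → L) → ℝ) (θ : V → L) :
    resample S (resample T F) θ = resample (S ∪ T) F θ := by
  unfold resample
  rw [← Finset.expect_product', Finset.univ_product_univ]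
  refine Fintype.expect_equiv (Equiv.piFinsetUnion (fun _ => L) h) _ _ fun η => ?_
  exact congrArg F (Function.updateFinset_updateFinset (π := fun _ => L) h)

theorem resample_inter [Nonempty L] {S N : Finset V} {F : (V → L) → ℝ}
    (hF : DependsOn F (N : Set V)) (θ : V → L) : resample S F θ = resample (S ∩ N) F θ := by
  conv_lhs => rw [← Finset.sdiff_union_inter S N, Finset.union_comm]
  rw [← resample_resample (Finset.disjoint_sdiff_inter S N).symm]
  refine resample_congr fun η => resample_eq_self hF ?_ _
  rw [Finset.coe_sdiff]
  exact Set.disjoint_sdiff_left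

/-- Coordinates that `F` ignores average out, so only the trace of the resampled set on `N` counts.
This allows passing from a ball to any larger vertex set. -/
theorem resample_eq_of_inter_eq [Nonempty L] {S S' N : Finset V}
    {F : (V → L) → ℝ} (hF : DependsOn F (N : Set V)) (h : S ∩ N = S' ∩ N) (θ : V → L) :
    resample S F θ = resample S' F θ := by
  rw [resample_inter hF, h, ← resample_inter hF]

theorem resample_mul_left {S : Finset V} {N : Set V} {F H : (V → L) → ℝ}
    (hF : DependsOn F N) (h : Disjoint (S : Set V) N) (θ : V → L) :
    resample S (fun θ => F θ * H θ) θ = F θ * resample S H θ := by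
  unfold resample
  rw [Finset.mul_expect]
  refine Finset.expect_congr rfl fun η _ => ?_
  have h1 : F (Function.updateFinset θ S η) = F θ :=
    hF fun x hx => updateFinset_eq_of_notMem fun hxS => h.le_bot ⟨hxS, hx⟩
  dsimp only
  rw [h1]

/-- Functions of disjoint sets of coordinates are independent. -/
theorem resample_mul [Nonempty L] {S A B : Finset V} {F H : (V → L) → ℝ}
    (hF : DependsOn F (A : Set V)) (hH : DependsOn H (B : Set V)) (hAB : Disjoint A B)
    (θ : V → L) :
    resample S (fun θ => F θ * H θ) θ = resample S F θ * resample S H θ := by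
  have h1 : resample S H θ = resample (S \ A) H θ := by
    refine resample_eq_of_inter_eq hH ?_ θ
    ext x
    have h2 : x ∈ A → x ∉ B := fun hx => Finset.disjoint_left.1 hAB hx
    simp only [Finset.mem_inter, Finset.mem_sdiff]
    tauto
  have hd : Disjoint (S ∩ A) (S \ A) := (Finset.disjoint_sdiff_inter S A).symm
  -- Average first over `S \ A`, where `F` is constant and factors out; the remaining average of `H`
  -- is constant in the coordinates of `S ∩ A`.
  conv_lhs => rw [← Finset.sdiff_union_inter S A, Finset.union_comm]
  rw [← resample_resample hd, h1, resample_inter hF, mul_comm,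
    ← resample_mul_left (S := S ∩ A) (resample_dependsOn (S := S \ A) hH)]
  · refine resample_congr fun η => ?_
    rw [resample_mul_left hF, mul_comm]
    rw [Finset.coe_sdiff]
    exact Set.disjoint_sdiff_left
  · rw [Set.disjoint_left]
    rintro x hx ⟨hxB, _⟩
    exact Finset.disjoint_left.1 hAB (Finset.mem_inter.1 hx).2 hxB

open Classical in
/-- The indicator function of a property of labelings. -/
noncomputable def indic (B : (V → L) → Prop) (θ : V → L) : ℝ := if B θ then 1 else 0

theorem indic_nonneg (B : (V → L) → Prop) (θ : V → L) : 0 ≤ indic B θ := by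
  unfold indic; split_ifs <;> norm_num

theorem indic_dependsOn {B : (V → L) → Prop} {N : Set V} (h : DependsOn B N) :
    DependsOn (indic B) N := fun θ θ' hθ => by
  unfold indic; rw [h hθ]

/-- Markov's inequality. -/
theorem resample_indic_le {S : Finset V} {F : (V → L) → ℝ} (hF : ∀ θ, 0 ≤ F θ) {a : ℝ}
    (ha : 0 < a) (θ : V → L) :
    resample S (indic fun θ => a < F θ) θ ≤ resample S F θ / a := by
  rw [← resample_div]
  refine resample_mono (fun θ => ?_) θ
  unfold indic
  split_ifs with h
  · rw [le_div_iff₀ ha, one_mul]; exact h.le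
  · exact div_nonneg (hF θ) ha.le

/-! ### The finite Lovász Local Lemma, revealing one coordinate at a time -/

section LocalLemma

variable {ι : Type*} (I : Finset ι) (S : ι → Finset V) (B : ι → (V → L) → Prop)

/-- None of the events determined by the coordinates in `X` occurs. -/
def AvoidsWithin (X : Finset V) (θ : V → L) : Prop := ∀ i ∈ I, S i ⊆ X → ¬ B i θ

variable {I S B}

theorem avoidsWithin_dependsOn (hB : ∀ i ∈ I, DependsOn (B i) (S i : Set V)) (X : Finset V) :
    DependsOn (AvoidsWithin I S B X) (X : Set V) := by
  intro θ θ' h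
  refine propext (forall₂_congr fun i hi => forall_congr' fun hX => not_congr ?_)
  rw [hB i hi fun x hx => h x (hX hx)]

/-- Write g(X) for the probability of avoiding all events inside X. Adding x brings in at most k new
events. The i-th is independent of avoidance within X \ S i, so it costs at most p·g(X \ S i). Going
back from X \ S i to X adds at most k coordinates, each costing a factor at least 1 - 1/(2k) by
induction on |X|, so g(X \ S i) ≤ 2g(X) by Bernoulli's inequality. The total loss is at most
2kp·g(X) ≤ g(X)/(2k). -/
theorem resample_avoidsWithin_insert [Nonempty L] {K : Finset V} {θ : V → L}
    {k : ℕ} {p : ℝ} (hk : 0 < k)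
    (hB : ∀ i ∈ I, DependsOn (B i) (S i : Set V))
    (hp : ∀ i ∈ I, resample K (indic (B i)) θ ≤ p) (hp0 : 0 ≤ p)
    (hcard : ∀ i ∈ I, (S i).card ≤ k)
    (hdeg : ∀ x, (I.filter fun i => x ∈ S i).card ≤ k) (hpk : 4 * (k : ℝ) ^ 2 * p ≤ 1)
    (X : Finset V) (x : V) (hx : x ∉ X) :
    (1 - 1 / (2 * k : ℝ)) * resample K (indic (AvoidsWithin I S B X)) θ ≤
      resample K (indic (AvoidsWithin I S B (insert x X))) θ := by
  have hk' : (1 : ℝ) ≤ k := by exact_mod_cast hk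
  set ε : ℝ := 1 / (2 * k : ℝ) with hε
  have hεpos : 0 < ε := by positivity
  have hεle : ε ≤ 1 / 2 := by
    rw [hε]; exact one_div_le_one_div_of_le (by norm_num) (by linarith)
  induction hn : X.card using Nat.strong_induction_on generalizing X x with
  | _ n ih =>
  subst hn
  set g : Finset V → ℝ := fun X => resample K (indic (AvoidsWithin I S B X)) θ with hg
  have hg0 : ∀ X, 0 ≤ g X := fun X => resample_nonneg (indic_nonneg _) θ
  -- The induction hypothesis, iterated over the points of `Z`; it applies because every
  -- intermediate set is strictly smaller than `X`.
  have chain : ∀ Z Y : Finset V, Disjoint Y Z → (Y ∪ Z).card ≤ X.card →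
      (1 - ε) ^ Z.card * g Y ≤ g (Y ∪ Z) := by
    intro Z
    induction Z using Finset.induction_on with
    | empty => intro Y _ _; simp
    | insert z Z hz ihZ =>
      intro Y hd hc
      rw [Finset.disjoint_insert_right] at hd
      have hzYZ : z ∉ Y ∪ Z := by simp [hd.1, hz]
      rw [Finset.union_insert, Finset.card_insert_of_notMem hzYZ] at hc
      have h1 := ihZ Y hd.2 (by omega)
      have h2 := ih (Y ∪ Z).card (by omega) (Y ∪ Z) z hzYZ rfl
      rw [Finset.card_insert_of_notMem hz, Finset.union_insert, pow_succ']
      refine le_trans ?_ h2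
      rw [mul_assoc]
      exact mul_le_mul_of_nonneg_left h1 (by linarith)
  set J := I.filter fun i => x ∈ S i ∧ S i ⊆ insert x X with hJ
  have hpoint : ∀ θ, indic (AvoidsWithin I S B X) θ -
      ∑ i ∈ J, indic (B i) θ * indic (AvoidsWithin I S B (X \ S i)) θ ≤
      indic (AvoidsWithin I S B (insert x X)) θ := by
    intro θ
    have hs : 0 ≤ ∑ i ∈ J, indic (B i) θ * indic (AvoidsWithin I S B (X \ S i)) θ :=
      Finset.sum_nonneg fun i _ => mul_nonneg (indic_nonneg _ _) (indic_nonneg _ _)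
    by_cases h1 : AvoidsWithin I S B X θ
    · by_cases h2 : AvoidsWithin I S B (insert x X) θ
      · simp only [indic, h1, h2, if_true]; simp only [indic] at hs; linarith
      · have : ∃ i ∈ I, S i ⊆ insert x X ∧ B i θ := by
          simpa [AvoidsWithin] using h2
        obtain ⟨i, hi, hiX, hiB⟩ := this
        have hxi : x ∈ S i := by
          by_contra hxi
          exact h1 i hi ((Finset.subset_insert_iff_of_notMem hxi).1 hiX) hiB
        have hiJ : i ∈ J := by simp [hJ, hi, hxi, hiX]
        have h3 : AvoidsWithin I S B (X \ S i) θ :=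
          fun j hj hjX => h1 j hj (hjX.trans Finset.sdiff_subset)
        have h4 := Finset.single_le_sum (f := fun i => indic (B i) θ *
          indic (AvoidsWithin I S B (X \ S i)) θ)
          (fun i _ => mul_nonneg (indic_nonneg _ _) (indic_nonneg _ _)) hiJ
        simp only [indic, h1, h2, h3, hiB, if_true, if_false] at h4 ⊢
        linarith
    · have : indic (AvoidsWithin I S B X) θ = 0 := by simp [indic, h1]
      have h5 := indic_nonneg (AvoidsWithin I S B (insert x X)) θ
      linarith
  have hsum := resample_mono (S := K) hpoint θ
  rw [resample_sub, resample_sum] at hsum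
  have hterm : ∀ i ∈ J, resample K (fun θ => indic (B i) θ *
      indic (AvoidsWithin I S B (X \ S i)) θ) θ ≤ p * (2 * g X) := by
    intro i hi
    obtain ⟨hiI, hxi, hiX⟩ := Finset.mem_filter.1 hi
    rw [resample_mul (indic_dependsOn (hB i hiI))
      (indic_dependsOn (avoidsWithin_dependsOn hB (X \ S i))) Finset.disjoint_sdiff]
    refine mul_le_mul (hp i hiI) ?_ (hg0 _) hp0
    have hd : Disjoint (X \ S i) (X ∩ S i) := Finset.disjoint_sdiff_inter X (S i)
    have hu : X \ S i ∪ X ∩ S i = X := Finset.sdiff_union_inter X (S i)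
    have h1 := chain (X ∩ S i) (X \ S i) hd (by rw [hu])
    rw [hu] at h1
    have hck : (X ∩ S i).card ≤ k :=
      (Finset.card_le_card Finset.inter_subset_right).trans (hcard i hiI)
    have h2 : (1 : ℝ) / 2 ≤ (1 - ε) ^ (X ∩ S i).card := by
      have hb := one_add_mul_le_pow (a := -ε) (by linarith) k
      have : (1 - ε) ^ k ≤ (1 - ε) ^ (X ∩ S i).card :=
        pow_le_pow_of_le_one (by linarith) (by linarith) hck
      have hkε : (k : ℝ) * ε = 1 / 2 := by rw [hε]; field_simp
      rw [← sub_eq_add_neg] at hb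
      linarith
    have h3 := mul_le_mul_of_nonneg_right h2 (hg0 (X \ S i))
    change g (X \ S i) ≤ _
    linarith
  have hsum2 := Finset.sum_le_card_nsmul J _ _ hterm
  have hJk : (J.card : ℝ) ≤ k := by
    refine Nat.cast_le.2 (le_trans (Finset.card_le_card ?_) (hdeg x))
    intro i hi
    simp only [hJ, Finset.mem_filter] at hi ⊢
    tauto
  rw [nsmul_eq_mul] at hsum2
  have h6 : (J.card : ℝ) * (p * (2 * g X)) ≤ k * (p * (2 * g X)) :=
    mul_le_mul_of_nonneg_right hJk (by have := hg0 X; positivity)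
  have h7 : (k : ℝ) * (p * 2) ≤ ε := by
    rw [hε, le_div_iff₀ (by positivity)]; linarith
  have h8 := mul_le_mul_of_nonneg_right h7 (hg0 X)
  change (1 - ε) * g X ≤ g (insert x X)
  change g X - _ ≤ g (insert x X) at hsum
  linarith

/-- A form of the Lovász Local Lemma for finitely many events, each depending on at most `k`
coordinates, such that each coordinate influences at most `k` events. -/
theorem exists_avoiding [Nonempty L] {K : Finset V} {θ : V → L}
    {k : ℕ} {p : ℝ} (hk : 0 < k)
    (hB : ∀ i ∈ I, DependsOn (B i) (S i : Set V))
    (hp : ∀ i ∈ I, resample K (indic (B i)) θ ≤ p) (hp0 : 0 ≤ p)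
    (hSK : ∀ i ∈ I, S i ⊆ K) (hne : ∀ i ∈ I, (S i).Nonempty)
    (hcard : ∀ i ∈ I, (S i).card ≤ k)
    (hdeg : ∀ x, (I.filter fun i => x ∈ S i).card ≤ k) (hpk : 4 * (k : ℝ) ^ 2 * p ≤ 1) :
    ∃ θ' : V → L, (∀ x ∉ K, θ' x = θ x) ∧ ∀ i ∈ I, ¬ B i θ' := by
  have hk' : (1 : ℝ) ≤ k := by exact_mod_cast hk
  have hε : 1 / (2 * k : ℝ) ≤ 1 / 2 := one_div_le_one_div_of_le (by norm_num) (by linarith)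
  have hpos : ∀ X : Finset V, 0 < resample K (indic (AvoidsWithin I S B X)) θ := by
    intro X
    induction X using Finset.induction_on with
    | empty =>
      -- No event lives inside the empty set, since each `S i` is nonempty.
      have h : ∀ θ, indic (AvoidsWithin I S B ∅) θ = 1 := by
        intro θ
        refine if_pos fun i hi h => ?_
        exact absurd (hne i hi) (by simp [Finset.subset_empty.1 h])
      unfold resample
      simp [h]
    | insert x X hx ih =>
      refine lt_of_lt_of_le (mul_pos ?_ ih)
        (resample_avoidsWithin_insert hk hB hp hp0 hcard hdeg hpk X x hx)
      linarith
  obtain ⟨θ', h1, h2⟩ := exists_pos_of_resample_pos (hpos K)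
  refine ⟨θ', h1, fun i hi => ?_⟩
  unfold indic at h2
  split_ifs at h2 with h
  · exact h i hi (hSK i hi)
  · exact absurd h2 (lt_irrefl _)

end LocalLemma

end Resample

/-! ### Balls -/

section Balls

variable {V : Type*} {G : SimpleGraph V}

theorem mem_ball_zero {v u : V} : u ∈ ball G v 0 ↔ u = v := by
  constructor
  · rintro ⟨p, hp⟩
    exact (SimpleGraph.Walk.eq_of_length_eq_zero (Nat.le_zero.mp hp)).symm
  · rintro rfl
    exact mem_ball_self G u 0

theorem mem_ball_succ {v u : V} {R : ℕ} :
    u ∈ ball G v (R + 1) ↔ u = v ∨ ∃ w, G.Adj v w ∧ u ∈ ball G w R := by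
  constructor
  · rintro ⟨p, hp⟩
    cases p with
    | nil => exact Or.inl rfl
    | cons h q => exact Or.inr ⟨_, h, q, by simpa using hp⟩
  · rintro (rfl | ⟨w, h, q, hq⟩)
    · exact mem_ball_self G u _
    · exact ⟨SimpleGraph.Walk.cons h q, by simpa using hq⟩

theorem mem_ball_comm {v u : V} {R : ℕ} : u ∈ ball G v R ↔ v ∈ ball G u R :=
  ⟨fun ⟨p, hp⟩ => ⟨p.reverse, by simpa using hp⟩, fun ⟨p, hp⟩ => ⟨p.reverse, by simpa using hp⟩⟩

theorem mem_ball_trans {v u w : V} {a b : ℕ} (h : u ∈ ball G v a) (h' : w ∈ ball G u b) :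
    w ∈ ball G v (a + b) := by
  obtain ⟨p, hp⟩ := h
  obtain ⟨q, hq⟩ := h'
  exact ⟨p.append q, by rw [SimpleGraph.Walk.length_append]; omega⟩

theorem ball_mono (v : V) {a b : ℕ} (h : a ≤ b) : ball G v a ⊆ ball G v b :=
  fun _ ⟨p, hp⟩ => ⟨p, hp.trans h⟩

theorem encard_ball_le {Δ : ℕ} (hΔ : ∀ v, (G.neighborSet v).encard ≤ Δ) (v : V) (R : ℕ) :
    (ball G v R).encard ≤ ((Δ + 1) ^ R : ℕ) := by
  classical
  induction R with
  | zero =>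
    have : ball G v 0 = {v} := Set.ext fun u => mem_ball_zero
    rw [this]; simp
  | succ R ih =>
    have hfin : (ball G v R).Finite := Set.finite_of_encard_le_coe ih
    have hnf : ∀ u, (G.neighborSet u).Finite := fun u => Set.finite_of_encard_le_coe (hΔ u)
    have hsub : ball G v (R + 1) ⊆
        (hfin.toFinset.biUnion fun u => insert u (hnf u).toFinset : Finset V) := by
      intro u hu
      -- Reversing the walk makes the recursion peel off its last edge, so the larger ball is
      -- covered by closed neighbourhoods of points of the smaller one.
      rw [mem_ball_comm, mem_ball_succ] at hu
      simp only [Finset.coe_biUnion, Set.Finite.coe_toFinset, Finset.coe_insert, Set.mem_iUnion,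
        Set.mem_insert_iff, SimpleGraph.mem_neighborSet, exists_prop]
      rcases hu with rfl | ⟨w, hw, hvw⟩
      · exact ⟨v, mem_ball_self G v R, Or.inl rfl⟩
      · exact ⟨w, mem_ball_comm.1 hvw, Or.inr hw.symm⟩
    refine (Set.encard_le_encard hsub).trans ?_
    rw [Set.encard_coe_eq_coe_finsetCard]
    refine Nat.cast_le.2 ((Finset.card_biUnion_le_card_mul _ _ (Δ + 1) fun u _ => ?_).trans ?_)
    · refine (Finset.card_insert_le _ _).trans (Nat.succ_le_succ ?_)
      have := hΔ u
      rw [(hnf u).encard_eq_coe_toFinset_card] at this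
      exact_mod_cast this
    · rw [pow_succ]
      refine Nat.mul_le_mul_right _ ?_
      rw [hfin.encard_eq_coe_toFinset_card] at ih
      exact_mod_cast ih

end Balls

/-! ### Borel sets with bounded sections -/

section Projection

open MeasureTheory

/-- The projection of a Borel set with sections of bounded finite size is Borel. -/
theorem measurableSet_projection {X Y : Type*} [MeasurableSpace X] [StandardBorelSpace X]
    [MeasurableSpace Y] [StandardBorelSpace Y] (k : ℕ) (E : Set (X × Y)) (hE : MeasurableSet E)
    (hk : ∀ x, {y | (x, y) ∈ E}.encard ≤ k) : MeasurableSet {x | ∃ y, (x, y) ∈ E} := by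
  induction k generalizing E with
  | zero =>
    convert MeasurableSet.empty
    rw [Set.eq_empty_iff_forall_notMem]
    rintro x ⟨y, hy⟩
    have h0 := hk x
    simp only [Nat.cast_zero, nonpos_iff_eq_zero, Set.encard_eq_zero] at h0
    exact (Set.eq_empty_iff_forall_notMem.1 h0) y hy
  | succ k ih =>
    set e := embeddingReal Y with he
    have hem : MeasurableEmbedding e := measurableEmbedding_embeddingReal Y
    -- Over a section with exactly k + 1 points, `D` contains only its increasing enumeration. The
    -- projection is thus injective on `D` and has Borel image by Lusin–Souslin; off this image the
    -- sections have at most k points and induction applies.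
    set D : Set (X × (Fin (k + 1) → Y)) :=
      {p | (∀ i, (p.1, p.2 i) ∈ E) ∧ ∀ i j, i < j → e (p.2 i) < e (p.2 j)} with hD
    have hDm : MeasurableSet D := by
      have : D = (⋂ i, {p | (p.1, p.2 i) ∈ E}) ∩
          ⋂ i, ⋂ j, ⋂ (_ : i < j), {p | e (p.2 i) < e (p.2 j)} := by
        ext p; simp [hD]
      rw [this]
      refine (MeasurableSet.iInter fun i => ?_).inter (MeasurableSet.iInter fun i =>
        MeasurableSet.iInter fun j => MeasurableSet.iInter fun _ => ?_)
      · exact measurableSet_preimage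
          (measurable_fst.prodMk ((measurable_pi_apply i).comp measurable_snd)) hE
      · exact measurableSet_lt (hem.measurable.comp ((measurable_pi_apply i).comp measurable_snd))
          (hem.measurable.comp ((measurable_pi_apply j).comp measurable_snd))
    have hrange : ∀ p ∈ D, Set.range (e ∘ p.2) = e '' {y | (p.1, y) ∈ E} := by
      rintro ⟨x, y⟩ ⟨h1, h2⟩
      have hfin : {y | (x, y) ∈ E}.Finite := Set.finite_of_encard_le_coe (hk x)
      refine (hfin.image e).eq_of_subset_of_encard_le' ?_ ?_
      · rintro _ ⟨i, rfl⟩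
        exact ⟨y i, h1 i, rfl⟩
      · have hinj : Function.Injective (e ∘ y) := (StrictMono.injective fun i j hij => h2 i j hij)
        rw [hem.injective.encard_image, ← Set.image_univ, hinj.encard_image]
        simpa using hk x
    have hinj : Set.InjOn Prod.fst D := by
      rintro ⟨x, y⟩ hp ⟨x', y'⟩ hq (rfl : x = x')
      have h := (hrange _ hp).trans (hrange _ hq).symm
      have h3 := (StrictMono.range_inj (f := e ∘ y) (g := e ∘ y') (fun i j hij => hp.2 i j hij)
        (fun i j hij => hq.2 i j hij)).1 h
      exact Prod.ext rfl (funext fun i => hem.injective (congrFun h3 i))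
    have hD1 : MeasurableSet (Prod.fst '' D) := hDm.image_of_measurable_injOn measurable_fst hinj
    have hE' := ih (E ∩ Prod.fst ⁻¹' (Prod.fst '' D)ᶜ)
      (hE.inter (measurable_fst hD1.compl)) fun x => by
        by_contra hlt
        rw [not_le] at hlt
        have hxD : x ∉ Prod.fst '' D := by
          intro hx
          have : {y | (x, y) ∈ E ∩ Prod.fst ⁻¹' (Prod.fst '' D)ᶜ} = ∅ :=
            Set.eq_empty_iff_forall_notMem.2 fun y hy => hy.2 hx
          rw [this] at hlt
          simp at hlt
        have hS : {y | (x, y) ∈ E ∩ Prod.fst ⁻¹' (Prod.fst '' D)ᶜ} = {y | (x, y) ∈ E} := by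
          ext y
          exact ⟨fun h => h.1, fun h => ⟨h, hxD⟩⟩
        rw [hS] at hlt
        have hfin : {y | (x, y) ∈ E}.Finite := Set.finite_of_encard_le_coe (hk x)
        have hfin' := hfin.image e
        have hcard : hfin'.toFinset.card = k + 1 := by
          have h1 := hem.injective.encard_image {y | (x, y) ∈ E}
          have h2 := hk x
          rw [hfin'.encard_eq_coe_toFinset_card] at h1
          rw [← h1] at hlt h2
          have h3 : k < hfin'.toFinset.card := by exact_mod_cast hlt
          have h4 : hfin'.toFinset.card ≤ k + 1 := by exact_mod_cast h2
          omega
        have hmem : ∀ i, ∃ y, (x, y) ∈ E ∧ e y = hfin'.toFinset.orderEmbOfFin hcard i := fun i => by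
          have := hfin'.toFinset.orderEmbOfFin_mem hcard i
          rw [Set.Finite.mem_toFinset] at this
          exact this
        choose y hy1 hy2 using hmem
        refine hxD ⟨(x, y), ⟨hy1, fun i j hij => ?_⟩, rfl⟩
        simp only [hy2]
        exact (hfin'.toFinset.orderEmbOfFin hcard).strictMono hij
    convert hD1.union hE' using 1
    ext x
    constructor
    · rintro ⟨y, hy⟩
      by_cases hx : x ∈ Prod.fst '' D
      · exact Or.inl hx
      · exact Or.inr ⟨y, hy, hx⟩
    · rintro (⟨p, hp, rfl⟩ | ⟨y, hy, _⟩)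
      · exact ⟨p.2 0, hp.1 0⟩
      · exact ⟨y, hy⟩

/-! ### Borel interpolation and enumeration of finite sets -/

variable {V : Type*} [MeasurableSpace V] [StandardBorelSpace V]

theorem measurableSet_exists_mem_ball {G : SimpleGraph V} (hG : IsBorelGraph G)
    (hdeg : FiniteMaxDegree G) (R : ℕ) {B : Set V} (hB : MeasurableSet B) :
    MeasurableSet {v | ∃ u ∈ ball G v R, u ∈ B} := by
  obtain ⟨Δ, hΔ⟩ := hdeg
  induction R with
  | zero => simpa [mem_ball_zero] using hB
  | succ R ih =>
    have h := measurableSet_projection Δ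
      ({p : V × V | G.Adj p.1 p.2} ∩ Prod.snd ⁻¹' {v | ∃ u ∈ ball G v R, u ∈ B})
      (MeasurableSet.inter hG (measurable_snd ih)) fun v =>
        (Set.encard_le_encard fun u hu => hu.1).trans (hΔ v)
    convert hB.union h using 1
    ext v
    simp only [mem_ball_succ, Set.mem_ofPred_eq, Set.mem_union, Set.mem_inter_iff,
      Set.mem_preimage]
    constructor
    · rintro ⟨u, rfl | ⟨w, hw, hu⟩, huB⟩
      · exact Or.inl huB
      · exact Or.inr ⟨w, hw, u, hu, huB⟩
    · rintro (hv | ⟨w, hw, u, hu, huB⟩)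
      · exact ⟨v, Or.inl rfl, hv⟩
      · exact ⟨u, Or.inr ⟨w, hw, hu⟩, huB⟩

/-- The function that takes the value `l` on the preimage of the interval `(a, b)` for the first
entry `(a, b, l)` of the list for which this is possible, and `d` elsewhere. -/
noncomputable def stepFunction {L : Type*} (d : L) : List (ℚ × ℚ × L) → ℝ → L
  | [], _ => d
  | (a, b, l) :: t, x => open Classical in if (a : ℝ) < x ∧ x < b then l else stepFunction d t x

theorem measurable_stepFunction {L : Type*} [MeasurableSpace L] (d : L) (t : List (ℚ × ℚ × L)) :
    Measurable (stepFunction d t) := by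
  induction t with
  | nil => exact measurable_const
  | cons p t ih =>
    obtain ⟨a, b, l⟩ := p
    exact Measurable.ite (measurableSet_Ioo (a := (a : ℝ)) (b := b)) measurable_const ih

theorem exists_stepFunction_eq {L : Type*} (d : L) (K : Finset ℝ) (a : ℝ → L) :
    ∃ t, ∀ x ∈ K, stepFunction d t x = a x := by
  induction K using Finset.induction_on with
  | empty => exact ⟨[], by simp⟩
  | insert x K hx ih =>
    obtain ⟨t, ht⟩ := ih
    -- A rational interval around `x` missing `K` goes in front of the list, so the earlier values
    -- on `K` survive. Rational endpoints keep the lists countable.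
    have hopen : (K : Set ℝ)ᶜ ∈ nhds x :=
      K.finite_toSet.isClosed.isOpen_compl.mem_nhds (by simpa using hx)
    obtain ⟨δ, hδ, hball⟩ := Metric.mem_nhds_iff.1 hopen
    obtain ⟨p, hp1, hp2⟩ := exists_rat_btwn (show x - δ < x by linarith)
    obtain ⟨q, hq1, hq2⟩ := exists_rat_btwn (show x < x + δ by linarith)
    refine ⟨(p, q, a x) :: t, fun y hy => ?_⟩
    rw [Finset.mem_insert] at hy
    by_cases hyx : y = x
    · subst hyx
      exact if_pos ⟨hp2, hq1⟩
    · have hyK : y ∈ K := hy.resolve_left hyx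
      refine (if_neg ?_).trans (ht y hyK)
      rintro ⟨h1, h2⟩
      have hyb : y ∈ Metric.ball x δ := by
        rw [Metric.mem_ball, Real.dist_eq, abs_lt]
        constructor <;> linarith
      exact hball hyb hyK

/-- There are countably many Borel functions that realize all functions on finite sets. -/
theorem exists_seq_measurable_interpolating (V : Type*) [MeasurableSpace V] [StandardBorelSpace V]
    (L : Type*) [MeasurableSpace L] [Countable L] [Nonempty L] :
    ∃ φ : ℕ → V → L, (∀ m, Measurable (φ m)) ∧
      ∀ (K : Finset V) (a : V → L), ∃ m, ∀ x ∈ K, φ m x = a x := by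
  classical
  obtain ⟨d⟩ := ‹Nonempty L›
  obtain ⟨s, hs⟩ := exists_surjective_nat (List (ℚ × ℚ × L))
  have hem := measurableEmbedding_embeddingReal V
  refine ⟨fun m v => stepFunction d (s m) (embeddingReal V v),
    fun m => (measurable_stepFunction d (s m)).comp hem.measurable, fun K a => ?_⟩
  obtain ⟨t, ht⟩ := exists_stepFunction_eq d (K.image (embeddingReal V))
    (fun r => if h : ∃ v, embeddingReal V v = r then a h.choose else d)
  obtain ⟨m, rfl⟩ := hs t
  refine ⟨m, fun x hx => ?_⟩
  have hex : ∃ v, embeddingReal V v = embeddingReal V x := ⟨x, rfl⟩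
  refine (ht _ (Finset.mem_image_of_mem _ hx)).trans ?_
  rw [dif_pos hex]
  exact congrArg a (hem.injective hex.choose_spec)

/-- Finite Borel neighbourhoods can be enumerated by countably many Borel functions. -/
theorem exists_seq_measurable_enumerating {N : V → Set V} (hfin : ∀ v, (N v).Finite)
    (hself : ∀ v, v ∈ N v)
    (hN : ∀ B, MeasurableSet B → MeasurableSet {v | ∃ u ∈ N v, u ∈ B}) :
    ∃ h : ℕ → V → V, (∀ k, Measurable (h k)) ∧ ∀ v, Set.range (fun k => h k v) = N v := by
  classical
  obtain ⟨φ, hφm, hφ⟩ := exists_seq_measurable_interpolating V Bool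
  have hA : ∀ k, MeasurableSet {u | φ k u = true} := fun k => hφm k (measurableSet_singleton true)
  -- `φ k` selects exactly one point of `N v`. The k-th function outputs that point, and defaults to
  -- `v` otherwise.
  let Q : ℕ → V → Prop := fun k v => ∃ u, (u ∈ N v ∧ φ k u = true) ∧
    ∀ u', u' ∈ N v ∧ φ k u' = true → u' = u
  have hQ : ∀ k, MeasurableSet {v | Q k v} := by
    intro k
    -- Uniqueness in countable form: the selected set is nonempty and no `φ j` splits it, as the `φ
    -- j` separate any two points.
    have : {v | Q k v} = {v | ∃ u ∈ N v, u ∈ {u | φ k u = true}} \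
        ⋃ j, {v | ∃ u ∈ N v, u ∈ {u | φ k u = true} ∩ {u | φ j u = true}} ∩
          {v | ∃ u ∈ N v, u ∈ {u | φ k u = true} \ {u | φ j u = true}} := by
      ext v
      simp only [Set.mem_ofPred_eq, Set.mem_sdiff, Set.mem_iUnion, Set.mem_inter_iff]
      constructor
      · rintro ⟨u, hu, huniq⟩
        refine ⟨⟨u, hu⟩, ?_⟩
        rintro ⟨j, ⟨u₁, h1, h1k, h1j⟩, ⟨u₂, h2, h2k, h2j⟩⟩
        rw [huniq u₁ ⟨h1, h1k⟩] at h1j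
        rw [huniq u₂ ⟨h2, h2k⟩] at h2j
        exact h2j h1j
      · rintro ⟨⟨u, hu⟩, hj⟩
        refine ⟨u, hu, fun u' hu' => ?_⟩
        by_contra hne
        obtain ⟨j, hj'⟩ := hφ {u, u'} (fun x => decide (x = u))
        refine hj ⟨j, ⟨u, hu.1, hu.2, ?_⟩, ⟨u', hu'.1, hu'.2, ?_⟩⟩
        · simpa using hj' u (by simp)
        · have := hj' u' (by simp)
          simp [hne] at this
          simp [this]
    rw [this]
    exact (hN _ (hA k)).diff (MeasurableSet.iUnion fun j =>
      (hN _ ((hA k).inter (hA j))).inter (hN _ ((hA k).diff (hA j))))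
  refine ⟨fun k v => if h : Q k v then h.choose else v, fun k B hB => ?_, fun v => ?_⟩
  · have : (fun v => if h : Q k v then h.choose else v) ⁻¹' B =
        ({v | Q k v} ∩ {v | ∃ u ∈ N v, u ∈ {u | φ k u = true} ∩ B}) ∪ ({v | Q k v}ᶜ ∩ B) := by
      ext v
      simp only [Set.mem_preimage, Set.mem_union, Set.mem_inter_iff, Set.mem_ofPred_eq,
        Set.mem_compl_iff]
      by_cases hv : Q k v
      · simp only [hv, dif_pos, true_and, not_true_eq_false, false_and, or_false]
        constructor
        · exact fun h => ⟨_, hv.choose_spec.1.1, hv.choose_spec.1.2, h⟩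
        · rintro ⟨u, hu, huk, huB⟩
          rwa [← hv.choose_spec.2 u ⟨hu, huk⟩]
      · simp [hv]
    rw [this]
    exact ((hQ k).inter (hN _ ((hA k).inter hB))).union ((hQ k).compl.inter hB)
  · ext u
    constructor
    · rintro ⟨k, rfl⟩
      dsimp only
      split_ifs with hv
      · exact hv.choose_spec.1.1
      · exact hself v
    · intro hu
      obtain ⟨k, hk⟩ := hφ (hfin v).toFinset (fun x => decide (x = u))
      have hv : Q k v := by
        refine ⟨u, ⟨hu, ?_⟩, fun u' hu' => ?_⟩
        · simpa using hk u (by simpa using hu)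
        · have := hk u' (by simpa using hu'.1)
          rw [hu'.2] at this
          simpa using this.symm
      refine ⟨k, ?_⟩
      dsimp only
      rw [dif_pos hv]
      refine (hv.choose_spec.2 u ⟨hu, ?_⟩).symm
      simpa using hk u (by simpa using hu)

/-- A set is Borel if membership is determined by finitely many Borel functions with countably
many values. -/
theorem measurableSet_of_pattern {ι : Type*} [Finite ι] (p : ι → V → ℕ)
    (hp : ∀ i, Measurable (p i)) (U S : Set V) (hU : MeasurableSet U) (hS : S ⊆ U)
    (h : ∀ v ∈ U, ∀ v' ∈ U, (∀ i, p i v = p i v') → v ∈ S → v' ∈ S) : MeasurableSet S := by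
  have hm : Measurable fun v i => p i v := measurable_pi_lambda _ hp
  have : S = U ∩ (fun v i => p i v) ⁻¹' ((fun v i => p i v) '' S) := by
    ext v
    constructor
    · exact fun hv => ⟨hS hv, v, hv, rfl⟩
    · rintro ⟨hv, v', hv', heq⟩
      exact h v' (hS hv') v hv (fun i => congrFun heq i) hv'
  rw [this]
  exact hU.inter (hm (Set.to_countable _).measurableSet)

end Projection

/-! ### Locality of isomorphism types of balls -/

section Locality

variable {V W : Type u}

/-- Short walks from `ι v` stay in the ball, hence in the range of `ι`, and so lift edge by edge. -/
theorem ball_eq_image {G : SimpleGraph V} {H : SimpleGraph W} {ι : V → W}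
    (hadj : ∀ a b, H.Adj (ι a) (ι b) ↔ G.Adj a b) {v : V} {R : ℕ}
    (hball : ball H (ι v) R ⊆ Set.range ι) : ball H (ι v) R = ι '' ball G v R := by
  induction R generalizing v with
  | zero =>
    ext w
    simp only [mem_ball_zero, Set.mem_image, exists_eq_left]
    exact eq_comm
  | succ R ih =>
    ext w
    rw [mem_ball_succ]
    constructor
    · rintro (rfl | ⟨x, hx, hw⟩)
      · exact ⟨v, mem_ball_self G v _, rfl⟩
      · obtain ⟨y, rfl⟩ := hball (mem_ball_succ.2 (Or.inr ⟨x, hx, mem_ball_self H x R⟩))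
        have hsub : ball H (ι y) R ⊆ Set.range ι :=
          fun z hz => hball (mem_ball_succ.2 (Or.inr ⟨_, hx, hz⟩))
        rw [ih hsub] at hw
        obtain ⟨z, hz, rfl⟩ := hw
        exact ⟨z, mem_ball_succ.2 (Or.inr ⟨y, (hadj _ _).1 hx, hz⟩), rfl⟩
    · rintro ⟨z, hz, rfl⟩
      rcases mem_ball_succ.1 hz with rfl | ⟨y, hy, hz⟩
      · exact Or.inl rfl
      · have hsub : ball H (ι y) R ⊆ Set.range ι :=
          fun z hz => hball (mem_ball_succ.2 (Or.inr ⟨_, (hadj _ _).2 hy, hz⟩))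
        refine Or.inr ⟨_, (hadj _ _).2 hy, ?_⟩
        rw [ih hsub]
        exact ⟨z, hz, rfl⟩

/-- The isomorphism type of a ball does not change under induced embeddings whose image contains
the ball. -/
theorem ballType_eq_of_embedding {G : StructuredGraph V} {H : StructuredGraph W}
    (hG : LocallyFinite G.graph) (hH : LocallyFinite H.graph) {ι : V → W}
    (hι : Function.Injective ι) (hadj : ∀ a b, H.graph.Adj (ι a) (ι b) ↔ G.graph.Adj a b)
    (hstr : ∀ x : Tuples V, H.str (x.map ι) = G.str x) {f : V → ℕ} {g : W → ℕ} {v : V} {R : ℕ}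
    (hball : ball H.graph (ι v) R ⊆ Set.range ι)
    (hfg : ∀ u ∈ ball G.graph v R, g (ι u) = f u) :
    ballType G hG f v R = ballType H hH g (ι v) R := by
  have himg := ball_eq_image hadj hball
  refine Quotient.sound ⟨Equiv.ofBijective
    (fun u : ball G.graph v R => (⟨ι u, himg ▸ ⟨u, u.2, rfl⟩⟩ : ball H.graph (ι v) R))
    ⟨fun a b hab => Subtype.ext (hι (congrArg Subtype.val hab)), ?_⟩,
    fun a b => hadj a b, fun x => hstr (x.map Subtype.val), fun a => hfg a a.2, rfl⟩
  rintro ⟨w, hw⟩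
  have hw' := hw
  rw [himg] at hw'
  obtain ⟨u, hu, rfl⟩ := hw'
  exact ⟨⟨u, hu⟩, rfl⟩

/-- The same for the isomorphism types of balls labeled by the output of an algorithm. -/
theorem ballType_output_eq_of_embedding {G : StructuredGraph V} {H : StructuredGraph W}
    (hG : LocallyFinite G.graph) (hH : LocallyFinite H.graph) (A : LocalAlgorithm.{u}) {ι : V → W}
    (hι : Function.Injective ι) (hadj : ∀ a b, H.graph.Adj (ι a) (ι b) ↔ G.graph.Adj a b)
    (hstr : ∀ x : Tuples V, H.str (x.map ι) = G.str x) {f : V → ℕ} {g : W → ℕ} {v : V} {T R : ℕ}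
    (hball : ball H.graph (ι v) (T + R) ⊆ Set.range ι)
    (hfg : ∀ u ∈ ball G.graph v (T + R), g (ι u) = f u) :
    ballType G hG (A.output T G hG f) v R = ballType H hH (A.output T H hH g) (ι v) R := by
  have hball' : ball H.graph (ι v) R ⊆ Set.range ι :=
    (ball_mono _ (Nat.le_add_left R T)).trans hball
  refine ballType_eq_of_embedding hG hH hι hadj hstr hball' fun u hu => congrArg A
    (ballType_eq_of_embedding hG hH hι hadj hstr (fun w hw => hball ?_) fun w hw => hfg w ?_).symm
  · have hιu : ι u ∈ ball H.graph (ι v) R := by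
      rw [ball_eq_image hadj hball']
      exact ⟨u, hu, rfl⟩
    rw [add_comm]
    exact mem_ball_trans hιu hw
  · rw [add_comm]
    exact mem_ball_trans hu hw

/-- The map `a i ↦ b i` is well defined and bijective because both enumerations repeat in the same
places. Isomorphism thus reduces to comparing patterns on indices. -/
theorem RootedLabeledGraph.iso_of_surjective {α : Type*} {X Y : RootedLabeledGraph.{u}}
    {a : α → X.carrier} {b : α → Y.carrier} (ha : Function.Surjective a)
    (hb : Function.Surjective b) (heq : ∀ i j, a i = a j ↔ b i = b j)
    (hadj : ∀ i j, X.graph.graph.Adj (a i) (a j) ↔ Y.graph.graph.Adj (b i) (b j))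
    (hstr : ∀ (k : ℕ) (x : Fin k → α),
      X.graph.str ⟨k, fun i => a (x i)⟩ = Y.graph.str ⟨k, fun i => b (x i)⟩)
    (hlabel : ∀ i, X.label (a i) = Y.label (b i))
    (hroot : ∀ i, a i = X.root ↔ b i = Y.root) : X.Iso Y := by
  have hs := Function.surjInv_eq ha
  have hφ : ∀ i, b (Function.surjInv ha (a i)) = b i := fun i => (heq _ _).1 (hs _)
  have hbij : Function.Bijective fun x => b (Function.surjInv ha x) := by
    refine ⟨fun x y hxy => ?_, fun y => ?_⟩
    · have := (heq _ _).2 hxy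
      rwa [hs, hs] at this
    · obtain ⟨i, rfl⟩ := hb y
      exact ⟨a i, hφ i⟩
  refine ⟨Equiv.ofBijective _ hbij, fun x y => ?_, fun x => ?_, fun x => ?_, ?_⟩
  · rw [Equiv.ofBijective_apply, Equiv.ofBijective_apply, ← hadj, hs, hs]
  · have h := hstr x.1 fun i => Function.surjInv ha (x.2 i)
    simp only [hs] at h
    exact h.symm
  · rw [Equiv.ofBijective_apply, ← hlabel, hs]
  · rw [Equiv.ofBijective_apply, ← hroot, hs]

end Locality

/-! ### Local functions are Borel -/

section LocalBorel

variable {V : Type u} [MeasurableSpace V] [StandardBorelSpace V]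

open Classical in
theorem measurable_indicator_nat {S : Set V} (hS : MeasurableSet S) :
    Measurable fun v => if v ∈ S then 1 else 0 :=
  Measurable.ite (α := V) (β := ℕ) hS measurable_const measurable_const

theorem StructuredGraph.IsBorel.measurable_str {G : StructuredGraph V} (h : G.IsBorel) :
    Measurable fun x : Tuples V => (G.str x).elim 0 Nat.succ := by
  refine measurable_to_countable' fun n => ?_
  cases n with
  | zero =>
    have : (fun x : Tuples V => (G.str x).elim 0 Nat.succ) ⁻¹' {0} =
        (⋃ i, {x : Tuples V | G.str x = some i})ᶜ := by
      ext x
      cases hx : G.str x <;> simp [hx]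
    rw [this]
    exact (MeasurableSet.iUnion h.2).compl
  | succ n =>
    convert h.2 n using 1
    ext x
    cases hx : G.str x <;> simp [hx]

open Classical in
-- Where the first q terms of a Borel enumeration exhaust the ball, its isomorphism type is read off
-- from finitely many Borel functions with values in ℕ.
theorem measurableSet_ballType {G : StructuredGraph V} (hB : G.IsBorel)
    (hdeg : FiniteMaxDegree G.graph) (hG : LocallyFinite G.graph) {f : V → ℕ} (hf : Measurable f)
    (R : ℕ) (S : Set IsoType.{u}) : MeasurableSet {v | ballType G hG f v R ∈ S} := by
  obtain ⟨h, hm, hr⟩ := exists_seq_measurable_enumerating (N := fun v => ball G.graph v R)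
    (fun v => ball_finite hG v R) (fun v => mem_ball_self G.graph v R)
    (fun B hBm => measurableSet_exists_mem_ball hB.1 hdeg R hBm)
  have hmem : ∀ k v, h k v ∈ ball G.graph v R := fun k v => hr v ▸ ⟨k, rfl⟩
  let U : ℕ → Set V := fun q => {v | ∀ k, ∃ i : Fin q, h k v = h i v}
  have hU : ∀ q, MeasurableSet (U q) := by
    intro q
    have : U q = ⋂ k, ⋃ i : Fin q, {v | h k v = h i v} := by ext v; simp [U]
    rw [this]
    exact MeasurableSet.iInter fun k => MeasurableSet.iUnion fun i =>
      measurableSet_eq_fun (hm k) (hm i)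
  have hcover : ∀ v, ∃ q, v ∈ U q := by
    intro v
    have hfin : (Set.range fun k => h k v).Finite := hr v ▸ ball_finite hG v R
    choose! j hj using fun u (hu : u ∈ Set.range fun k => h k v) => hu
    obtain ⟨q, hq⟩ := (hfin.image j).bddAbove
    refine ⟨q + 1, fun k => ⟨⟨j (h k v), Nat.lt_succ_of_le (hq ⟨_, ⟨k, rfl⟩, rfl⟩)⟩, ?_⟩⟩
    exact (hj _ ⟨k, rfl⟩).symm
  have hunion : {v | ballType G hG f v R ∈ S} = ⋃ q, U q ∩ {v | ballType G hG f v R ∈ S} := by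
    ext v
    obtain ⟨q, hq⟩ := hcover v
    simp only [Set.mem_iUnion, Set.mem_inter_iff]
    exact ⟨fun hv => ⟨q, hq, hv⟩, fun ⟨_, _, hv⟩ => hv⟩
  rw [hunion]
  refine MeasurableSet.iUnion fun q => ?_
  -- The bound on tuple lengths leaves finitely many index tuples to record.
  obtain ⟨ℓ, hℓ⟩ := G.bounded
  let p : (Fin q × Fin q) ⊕ (Fin q × Fin q) ⊕ (Σ k : Fin (ℓ + 1), Fin k → Fin q) ⊕
      Fin q ⊕ Fin q → V → ℕ := fun i => match i with
    | .inl (i, j) => fun v => if v ∈ {v | h i v = h j v} then 1 else 0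
    | .inr (.inl (i, j)) => fun v => if v ∈ {v | G.graph.Adj (h i v) (h j v)} then 1 else 0
    | .inr (.inr (.inl ⟨k, x⟩)) => fun v =>
      (G.str ⟨k, fun i => h (x i) v⟩).elim 0 Nat.succ
    | .inr (.inr (.inr (.inl i))) => fun v => f (h i v)
    | .inr (.inr (.inr (.inr i))) => fun v => if v ∈ {v | h i v = v} then 1 else 0
  have hp : ∀ i, Measurable (p i) := by
    rintro (⟨i, j⟩ | ⟨i, j⟩ | ⟨k, x⟩ | i | i)
    · exact measurable_indicator_nat (measurableSet_eq_fun (hm i) (hm j))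
    · exact measurable_indicator_nat (((hm i).prodMk (hm j)) hB.1)
    · refine hB.measurable_str.comp (g := fun x : Tuples V => (G.str x).elim 0 Nat.succ)
        (f := fun v => (⟨k, fun i => h (x i) v⟩ : Tuples V)) ?_
      exact (measurable_iff_le_map.2 (iInf_le _ (k : ℕ))).comp
        (measurable_pi_lambda _ fun i => hm (x i))
    · exact hf.comp (hm i)
    · exact measurable_indicator_nat (measurableSet_eq_fun (hm i) measurable_id)
  refine measurableSet_of_pattern p hp (U q) _ (hU q) Set.inter_subset_left ?_
  rintro v hv v' hv' heq ⟨_, hvS⟩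
  refine ⟨hv', ?_⟩
  have hite : ∀ P Q : Prop, ((if P then 1 else 0 : ℕ) = if Q then 1 else 0) → (P ↔ Q) := by
    intro P Q hPQ
    by_cases hP : P <;> by_cases hQ : Q <;> simp [hP, hQ] at hPQ ⊢
  suffices hiso : ballType G hG f v R = ballType G hG f v' R by
    change ballType G hG f v' R ∈ S
    rw [← hiso]; exact hvS
  have hsurj : ∀ v ∈ U q, Function.Surjective
      fun i : Fin q => (⟨h i v, hmem i v⟩ : ball G.graph v R) := by
    rintro v hv ⟨u, hu⟩
    have hu' := hu
    rw [← hr v] at hu'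
    obtain ⟨k, rfl⟩ := hu'
    obtain ⟨i, hi⟩ := hv k
    exact ⟨i, Subtype.ext hi.symm⟩
  refine Quotient.sound (RootedLabeledGraph.iso_of_surjective (hsurj v hv) (hsurj v' hv')
    (fun i j => ?_) (fun i j => hite _ _ (heq (.inr (.inl (i, j))))) (fun k x => ?_)
    (fun i => heq (.inr (.inr (.inr (.inl i))))) (fun i => ?_))
  · rw [Subtype.mk.injEq, Subtype.mk.injEq]
    exact hite _ _ (heq (.inl (i, j)))
  · change G.str ⟨k, fun i => h (x i) v⟩ = G.str ⟨k, fun i => h (x i) v'⟩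
    by_cases hk : k ≤ ℓ
    · have h1 : (G.str ⟨k, fun i => h (x i) v⟩).elim 0 Nat.succ =
        (G.str ⟨k, fun i => h (x i) v'⟩).elim 0 Nat.succ :=
        heq (.inr (.inr (.inl ⟨⟨k, Nat.lt_succ_of_le hk⟩, x⟩)))
      revert h1
      generalize G.str ⟨k, fun i => h (x i) v⟩ = a
      generalize G.str ⟨k, fun i => h (x i) v'⟩ = b
      cases a <;> cases b <;> simp
    · have hnone : ∀ y : Fin k → V, G.str ⟨k, y⟩ = none := fun y => by
        by_contra hne
        exact hk (hℓ _ hne)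
      rw [hnone, hnone]
  · change (⟨h i v, _⟩ : ball G.graph v R) = ⟨v, _⟩ ↔ (⟨h i v', _⟩ : ball G.graph v' R) = ⟨v', _⟩
    rw [Subtype.mk.injEq, Subtype.mk.injEq]
    exact hite _ _ (heq (.inr (.inr (.inr (.inr i)))))

end LocalBorel

/-! ### A Borel Local Lemma -/

section BorelLocalLemma

variable {V : Type*} {L : Type*} [DecidableEq V] [Fintype L]
  {N : V → Finset V} {bad : V → (V → L) → Prop}

open Classical in
/-- The elements of a finite set outside of a given set. -/
noncomputable def outside (S : Finset V) (D : Set V) : Finset V := S.filter (· ∉ D)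

theorem mem_outside {S : Finset V} {D : Set V} {x : V} : x ∈ outside S D ↔ x ∈ S ∧ x ∉ D := by
  simp [outside]

/-- The conditional probability of the bad event at `v` when the labels on `D` are those of `θ`. -/
noncomputable def condProb (N : V → Finset V) (bad : V → (V → L) → Prop) (D : Set V) (θ : V → L)
    (v : V) : ℝ :=
  resample (outside (N v) D) (indic (bad v)) θ

/-- Conditional probabilities are local, which is what lets labels chosen on separate components be
glued. -/
theorem condProb_congr (hbad : ∀ v, DependsOn (bad v) (N v : Set V)) {D D' : Set V}
    {θ θ' : V → L} {v : V} (hD : ∀ x ∈ N v, x ∈ D ↔ x ∈ D') (hθ : ∀ x ∈ N v, θ x = θ' x) :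
    condProb N bad D θ v = condProb N bad D' θ' v := by
  unfold condProb
  have h : outside (N v) D = outside (N v) D' := by
    ext x
    rw [mem_outside, mem_outside]
    exact and_congr_right fun hx => not_congr (hD x hx)
  rw [h]
  exact resample_dependsOn (indic_dependsOn (hbad v)) fun x hx => hθ x hx.1

theorem condProb_nonneg {D : Set V} {θ : V → L} {v : V} : 0 ≤ condProb N bad D θ v :=
  resample_nonneg (indic_nonneg _) _

/-- The labels on a finite set `K` can be fixed without increasing the conditional probabilities
too much. -/
theorem exists_extension [Nonempty L] (hbad : ∀ v, DependsOn (bad v) (N v : Set V))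
    (hsymm : ∀ u v, u ∈ N v → v ∈ N u) {M : ℕ} (hM : 0 < M) (hcard : ∀ v, (N v).card ≤ M)
    {K : Finset V} {D : Set V} (hKD : ∀ x ∈ K, x ∉ D) {θ : V → L} {c : ℝ} (hc : 0 < c)
    (hcp : ∀ v, condProb N bad D θ v ≤ c) :
    ∃ a : V → L, (∀ x ∉ K, a x = θ x) ∧ ∀ v, ∀ y ∈ K, y ∈ N v →
      condProb N bad (D ∪ K) a v ≤ 4 * (M : ℝ) ^ 2 * c := by
  have hM' : (0 : ℝ) < M := by exact_mod_cast hM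
  have hpos : 0 < 4 * (M : ℝ) ^ 2 * c := by positivity
  -- The new conditional probability as a function of the labels on `K`. Its average over these
  -- labels is the old one, by total probability.
  let F : V → (V → L) → ℝ := fun v a => condProb N bad (D ∪ K) (K.piecewise a θ) v
  have hF0 : ∀ v a, 0 ≤ F v a := fun v a => condProb_nonneg
  have hFdep : ∀ v, DependsOn (F v) ((N v ∩ K : Finset V) : Set V) := by
    intro v a b hab
    refine condProb_congr hbad (fun x _ => Iff.rfl) fun x hx => ?_
    by_cases hxK : x ∈ K
    · simpa [hxK] using hab x (by simp [hx, hxK])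
    · simp [hxK]
  have hFavg : ∀ v, resample K (F v) θ ≤ c := by
    intro v
    refine le_trans (le_of_eq ?_) (hcp v)
    classical
    have hd : Disjoint K (outside (N v) (D ∪ K)) := by
      rw [Finset.disjoint_left]
      intro x hx hx'
      exact (mem_outside.1 hx').2 (Or.inr hx)
    have h1 : resample K (F v) θ =
        resample K (resample (outside (N v) (D ∪ K)) (indic (bad v))) θ := by
      refine resample_congr fun η => ?_
      refine condProb_congr hbad (fun x _ => Iff.rfl) fun x _ => ?_
      by_cases hxK : x ∈ K
      · simp [hxK]
      · simp [hxK, updateFinset_eq_of_notMem hxK]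
    rw [h1, resample_resample hd]
    refine resample_eq_of_inter_eq (indic_dependsOn (hbad v)) ?_ θ
    ext x
    have hx := hKD x
    simp only [Finset.mem_inter, Finset.mem_union, mem_outside, Set.mem_union,
      Finset.mem_coe]
    tauto
  -- By Markov's inequality, each event F > 4M²c has probability at most 1/(4M²), exactly what the
  -- Local Lemma with k = M tolerates. By symmetry of `N`, `K.biUnion N` consists of the vertices
  -- whose neighbourhood meets `K`.
  obtain ⟨a, ha, hav⟩ := exists_avoiding (I := K.biUnion N) (S := fun v => N v ∩ K)
    (B := fun v a => 4 * (M : ℝ) ^ 2 * c < F v a) (K := K) (θ := θ) (k := M)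
    (p := c / (4 * (M : ℝ) ^ 2 * c)) hM
    (fun v _ a b hab => by dsimp only; rw [hFdep v hab])
    (fun v _ => (resample_indic_le (hF0 v) hpos θ).trans
      (div_le_div_of_nonneg_right (hFavg v) hpos.le))
    (by positivity) (fun v _ => Finset.inter_subset_right)
    (fun v hv => by
      obtain ⟨x, hx, hv⟩ := Finset.mem_biUnion.1 hv
      exact ⟨x, Finset.mem_inter.2 ⟨hsymm _ _ hv, hx⟩⟩)
    (fun v _ => (Finset.card_le_card Finset.inter_subset_left).trans (hcard v))
    (fun x => (Finset.card_le_card fun v hv => by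
      exact hsymm _ _ (Finset.mem_inter.1 (Finset.mem_filter.1 hv).2).1).trans (hcard x))
    (by rw [← mul_div_assoc, div_self hpos.ne'])
  refine ⟨a, ha, fun v y hy hyv => ?_⟩
  have h1 := not_lt.1 (hav v (Finset.mem_biUnion.2 ⟨y, hy, hsymm _ _ hyv⟩))
  refine le_trans (le_of_eq (condProb_congr hbad (fun x _ => Iff.rfl) fun x _ => ?_)) h1
  by_cases hxK : x ∈ K
  · simp [hxK]
  · simp [hxK, ha x hxK]

/-! ### Fixing the labels in a Borel way -/

variable [MeasurableSpace V] [StandardBorelSpace V] [MeasurableSpace L]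
  [MeasurableSingletonClass L]

/-- The average runs over labelings of a set that varies with v. It is rewritten, on countably many
Borel pieces, as an average over a fixed finite set of globally defined Borel labelings. -/
theorem measurableSet_condProb_gt [Nonempty L] (hbad : ∀ v, DependsOn (bad v) (N v : Set V))
    (hN : ∀ B, MeasurableSet B → MeasurableSet {v | ∃ u ∈ N v, u ∈ B})
    (hbadm : ∀ θ : V → L, Measurable θ → MeasurableSet {v | bad v θ})
    {D : Set V} (hD : MeasurableSet D) {θ : V → L} (hθ : Measurable θ) (c : ℝ) :
    MeasurableSet {v | c < condProb N bad D θ v} := by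
  classical
  obtain ⟨φ, hφm, hφ⟩ := exists_seq_measurable_interpolating V L
  let ψ : ℕ → V → L := fun m x => if x ∈ D then θ x else φ m x
  have hψ : ∀ m, Measurable (ψ m) := fun m => Measurable.ite hD hθ (hφm m)
  let W : ℕ → ℕ → Set V := fun m m' => {v | ∃ u ∈ N v, u ∈ Dᶜ \ {u | φ m u = φ m' u}}
  have hW : ∀ m m', MeasurableSet (W m m') := fun m m' =>
    hN _ (hD.compl.diff (measurableSet_eq_fun (hφm m) (hφm m')))
  -- For v in `Q Φ`, the functions `φ m` with m in Φ represent each labeling of `N v` outside `D`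
  -- exactly once.
  let Q : Finset ℕ → Set V := fun Φ => (⋂ m ∈ Φ, ⋂ m' ∈ Φ, ⋂ (_ : m ≠ m'), W m m') ∩
    ⋂ m, ⋃ m' ∈ Φ, (W m m')ᶜ
  have hQ : ∀ Φ, MeasurableSet (Q Φ) := fun Φ =>
    (Finset.measurableSet_biInter _ fun m _ => Finset.measurableSet_biInter _ fun m' _ =>
      MeasurableSet.iInter fun _ => hW m m').inter
    (MeasurableSet.iInter fun m => Finset.measurableSet_biUnion _ fun m' _ => (hW m m').compl)
  have hnW : ∀ {m m' v}, v ∉ W m m' ↔ ∀ u ∈ N v, u ∉ D → φ m u = φ m' u := by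
    intro m m' v
    simp only [W, Set.mem_ofPred_eq, not_exists, not_and, Set.mem_sdiff, Set.mem_compl_iff, not_not]
  have heq : ∀ Φ, ∀ v ∈ Q Φ, condProb N bad D θ v =
      Finset.expect Φ fun m => indic (bad v) (ψ m) := by
    rintro Φ v ⟨h1, h2⟩
    simp only [Set.mem_iInter, Set.mem_iUnion, Set.mem_compl_iff, exists_prop] at h1 h2
    symm
    refine Finset.expect_nbij (fun m (x : (outside (N v) D : Finset V)) => φ m x)
      (fun _ _ => Finset.mem_univ _) (fun m _ => ?_) ?_ ?_
    · refine indic_dependsOn (hbad v) fun x hx => ?_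
      by_cases hxD : x ∈ D
      · rw [updateFinset_eq_of_notMem (by simp [mem_outside, hxD])]
        simp [ψ, hxD]
      · rw [updateFinset_eq_of_mem (by simpa [mem_outside, hxD] using hx)]
        simp [ψ, hxD]
    · intro m hm m' hm' hmm
      by_contra hne
      refine absurd (h1 m hm m' hm' hne) (hnW.2 fun u hu huD => ?_)
      exact congrFun hmm ⟨u, mem_outside.2 ⟨hu, huD⟩⟩
    · intro η _
      obtain ⟨m, hm⟩ := hφ (outside (N v) D) (Function.updateFinset θ _ η)
      obtain ⟨m', hm', hmm⟩ := h2 m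
      refine ⟨m', hm', funext fun x => ?_⟩
      have hx := mem_outside.1 x.2
      change φ m' x = η x
      rw [← hnW.1 hmm x hx.1 hx.2, hm x x.2, updateFinset_eq_of_mem x.2]
  have hex : ∀ v, ∃ Φ, v ∈ Q Φ := by
    intro v
    choose m hm using fun η : (outside (N v) D : Finset V) → L =>
      hφ (outside (N v) D) (Function.updateFinset θ _ η)
    refine ⟨Finset.univ.image m, ?_⟩
    refine ⟨?_, ?_⟩
    · simp only [Set.mem_iInter]
      intro i hi j hj hij
      obtain ⟨η, _, rfl⟩ := Finset.mem_image.1 hi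
      obtain ⟨η', _, rfl⟩ := Finset.mem_image.1 hj
      by_contra hW'
      refine hij (congrArg m (funext fun x => ?_))
      have hx := mem_outside.1 x.2
      have := hnW.1 hW' x hx.1 hx.2
      rwa [hm η x x.2, hm η' x x.2, updateFinset_eq_of_mem x.2, updateFinset_eq_of_mem x.2] at this
    · simp only [Set.mem_iInter, Set.mem_iUnion, Set.mem_compl_iff, exists_prop]
      intro i
      refine ⟨m fun x => φ i x, Finset.mem_image_of_mem _ (Finset.mem_univ _), hnW.2 ?_⟩
      intro u hu huD
      have hmem : u ∈ outside (N v) D := mem_outside.2 ⟨hu, huD⟩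
      rw [hm _ u hmem, updateFinset_eq_of_mem hmem]
  have hset : {v | c < condProb N bad D θ v} =
      ⋃ Φ : Finset ℕ, Q Φ ∩ {v | c < Finset.expect Φ fun m => indic (bad v) (ψ m)} := by
    ext v
    simp only [Set.mem_iUnion, Set.mem_inter_iff, Set.mem_ofPred_eq]
    constructor
    · intro h
      obtain ⟨Φ, hΦ⟩ := hex v
      exact ⟨Φ, hΦ, heq Φ v hΦ ▸ h⟩
    · rintro ⟨Φ, hΦ, h⟩
      rwa [heq Φ v hΦ]
  rw [hset]
  refine MeasurableSet.iUnion fun Φ => (hQ Φ).inter (measurableSet_lt measurable_const ?_)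
  simp only [Finset.expect_eq_sum_div_card]
  refine (Finset.measurable_fun_sum _ fun m _ => ?_).div_const _
  exact Measurable.ite (hbadm _ (hψ m)) measurable_const measurable_const

/-- Two vertices of `U` with a common neighbourhood. -/
def Linked (N : V → Finset V) (U : Set V) (x y : V) : Prop :=
  x ∈ U ∧ y ∈ U ∧ ∃ z ∈ N x, y ∈ N z

/-- A union over the length of the chain of links; each link is two applications of `hN`. -/
theorem measurableSet_exists_linked
    (hN : ∀ B, MeasurableSet B → MeasurableSet {v | ∃ u ∈ N v, u ∈ B}) {U : Set V}
    (hU : MeasurableSet U) {B : Set V} (hB : MeasurableSet B) :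
    MeasurableSet {x | ∃ y, Relation.ReflTransGen (Linked N U) x y ∧ y ∈ B} := by
  let S : ℕ → Set V := fun n =>
    Nat.rec B (fun _ S => U ∩ {x | ∃ z ∈ N x, z ∈ {z | ∃ y ∈ N z, y ∈ U ∩ S}}) n
  have hS : ∀ n, MeasurableSet (S n) := by
    intro n
    induction n with
    | zero => exact hB
    | succ n ih => exact hU.inter (hN _ (hN _ (hU.inter ih)))
  have : {x | ∃ y, Relation.ReflTransGen (Linked N U) x y ∧ y ∈ B} = ⋃ n, S n := by
    ext x
    rw [Set.mem_iUnion]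
    constructor
    · rintro ⟨y, hxy, hy⟩
      induction hxy using Relation.ReflTransGen.head_induction_on with
      | refl => exact ⟨0, hy⟩
      | head h _ ih =>
        obtain ⟨n, hn⟩ := ih
        obtain ⟨hx, hc, z, hz, hcz⟩ := h
        exact ⟨n + 1, hx, z, hz, _, hcz, hc, hn⟩
    · rintro ⟨n, hn⟩
      induction n generalizing x with
      | zero => exact ⟨x, .refl, hn⟩
      | succ n ih =>
        obtain ⟨hx, z, hz, w, hw, hwU, hwS⟩ := hn
        obtain ⟨y, hy, hyB⟩ := ih w hwS
        exact ⟨y, .head ⟨hx, hwU, z, hz, hw⟩ hy, hyB⟩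
  rw [this]
  exact MeasurableSet.iUnion hS

/-- The labels on a Borel set with finite components can be fixed in a Borel way without increasing
the conditional probabilities too much. -/
theorem exists_measurable_extension [Nonempty L] (hbad : ∀ v, DependsOn (bad v) (N v : Set V))
    (hsymm : ∀ u v, u ∈ N v → v ∈ N u) {M : ℕ} (hM : 0 < M) (hcard : ∀ v, (N v).card ≤ M)
    (hN : ∀ B, MeasurableSet B → MeasurableSet {v | ∃ u ∈ N v, u ∈ B})
    (hbadm : ∀ θ : V → L, Measurable θ → MeasurableSet {v | bad v θ})
    {D U : Set V} (hD : MeasurableSet D) (hU : MeasurableSet U) (hUD : ∀ x ∈ U, x ∉ D)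
    (hfin : ∀ x ∈ U, {y | Relation.ReflTransGen (Linked N U) x y}.Finite)
    {θ : V → L} (hθ : Measurable θ) {c : ℝ} (hc : 0 < c)
    (hcp : ∀ v, condProb N bad D θ v ≤ c) :
    ∃ θ' : V → L, Measurable θ' ∧ ∀ v, condProb N bad (D ∪ U) θ' v ≤ 4 * (M : ℝ) ^ 2 * c := by
  classical
  obtain ⟨φ, hφm, hφ⟩ := exists_seq_measurable_interpolating V L
  let ψ : ℕ → V → L := fun m x => if x ∈ U then φ m x else θ x
  have hψ : ∀ m, Measurable (ψ m) := fun m => Measurable.ite hU (hφm m) hθ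
  let Z : ℕ → Set V := fun m => {v | 4 * (M : ℝ) ^ 2 * c < condProb N bad (D ∪ U) (ψ m) v}
  have hZ : ∀ m, MeasurableSet (Z m) := fun m =>
    measurableSet_condProb_gt hbad hN hbadm (hD.union hU) (hψ m) _
  -- The points whose component sees a vertex for which labeling by `φ m` is too costly; this set is
  -- a union of components, up to points outside `U`.
  let Y : ℕ → Set V := fun m =>
    {x | ∃ y, Relation.ReflTransGen (Linked N U) x y ∧ y ∈ {y | ∃ v ∈ N y, v ∈ Z m}}
  have hY : ∀ m, MeasurableSet (Y m) := fun m => measurableSet_exists_linked hN hU (hN _ (hZ m))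
  have : Std.Symm (Linked N U) :=
    ⟨fun x y ⟨hx, hy, z, hz, hyz⟩ => ⟨hy, hx, z, hsymm _ _ hyz, hsymm _ _ hz⟩⟩
  have hsym : ∀ {x y}, Relation.ReflTransGen (Linked N U) x y →
      Relation.ReflTransGen (Linked N U) y x := fun h => symm h
  have hmemU : ∀ x ∈ U, ∀ y, Relation.ReflTransGen (Linked N U) x y → y ∈ U := by
    intro x hx y hxy
    induction hxy with
    | refl => exact hx
    | tail _ h _ => exact h.2.1
  have hex : ∀ x, ∃ m, x ∈ (Y m)ᶜ ∪ Uᶜ := by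
    intro x
    by_cases hx : x ∈ U
    · set K := (hfin x hx).toFinset with hK
      have hKmem : ∀ y, y ∈ K ↔ Relation.ReflTransGen (Linked N U) x y := fun y => by simp [hK]
      have hKU : ∀ y ∈ K, y ∈ U := fun y hy => hmemU x hx y ((hKmem y).1 hy)
      obtain ⟨a, ha1, ha2⟩ := exists_extension hbad hsymm hM hcard
        (fun y hy => hUD y (hKU y hy)) hc hcp (K := K)
      obtain ⟨m, hm⟩ := hφ K a
      refine ⟨m, Or.inl ?_⟩
      rintro ⟨y, hxy, v, hv, hvZ⟩
      refine absurd hvZ (not_lt.2 (le_trans (le_of_eq ?_)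
        (ha2 v y ((hKmem y).2 hxy) (hsymm _ _ hv))))
      have hyU := hmemU x hx y hxy
      -- All points of `U` in one neighbourhood are linked, so `N v` meets no other component.
      have huK : ∀ u ∈ N v, u ∈ U → u ∈ K := fun u hu huU =>
        (hKmem u).2 (hxy.tail ⟨hyU, huU, v, hv, hu⟩)
      refine condProb_congr hbad (fun u hu => or_congr Iff.rfl ⟨huK u hu, hKU u⟩) fun u hu => ?_
      by_cases huU : u ∈ U
      · simpa [ψ, huU] using hm u (huK u hu huU)
      · simpa [ψ, huU] using (ha1 u fun h => huU (hKU u h)).symm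
    · exact ⟨0, Or.inr hx⟩
  -- The least index that works is constant on each component, so the glued labeling agrees there
  -- with a single `φ m`.
  let ν : V → ℕ := fun x => Nat.find (hex x)
  have hν : Measurable ν := measurable_find hex fun k => (hY k).compl.union hU.compl
  have hνeq : ∀ x ∈ U, ∀ y, Relation.ReflTransGen (Linked N U) x y → ν x = ν y := by
    intro x hx y hxy
    have hy := hmemU x hx y hxy
    refine Nat.find_congr' fun {m} => or_congr (not_congr ?_) (by simp [hx, hy])
    exact ⟨fun ⟨z, hz, h⟩ => ⟨z, (hsym hxy).trans hz, h⟩, fun ⟨z, hz, h⟩ => ⟨z, hxy.trans hz, h⟩⟩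
  refine ⟨fun x => if x ∈ U then φ (ν x) x else θ x, Measurable.ite hU ?_ hθ, fun v => ?_⟩
  · exact (measurable_from_prod_countable_right (f := fun p : ℕ × V => φ p.1 p.2) hφm).comp
      (hν.prodMk measurable_id)
  · by_cases hvU : ∃ y ∈ N v, y ∈ U
    · obtain ⟨y, hy, hyU⟩ := hvU
      have h1 : y ∉ Y (ν y) := (Nat.find_spec (hex y)).resolve_right fun h => h hyU
      have h2 : v ∉ Z (ν y) := fun h => h1 ⟨y, .refl, v, hsymm _ _ hy, h⟩
      refine le_trans (le_of_eq ?_) (not_lt.1 h2)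
      refine condProb_congr hbad (fun _ _ => Iff.rfl) fun u hu => ?_
      by_cases huU : u ∈ U
      · simp only [ψ, huU, if_true]
        rw [hνeq y hyU u (.single ⟨hyU, huU, v, hsymm _ _ hy, hu⟩)]
      · simp [ψ, huU]
    -- If `N v` misses `U`, nothing changes at v, and 4M² ≥ 1.
    · push Not at hvU
      have h1 : condProb N bad (D ∪ U) (fun x => if x ∈ U then φ (ν x) x else θ x) v =
          condProb N bad D θ v := by
        refine condProb_congr hbad (fun u hu => by simp [hvU u hu]) fun u hu => ?_
        simp [hvU u hu]
      rw [h1]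
      refine (hcp v).trans (le_mul_of_one_le_left hc.le ?_)
      have hM' : (1 : ℝ) ≤ M := by exact_mod_cast hM
      nlinarith

/-- A Borel version of the Local Lemma, for a space split into finitely many Borel sets with finite
components. -/
theorem exists_measurable_avoiding [Nonempty L] (hbad : ∀ v, DependsOn (bad v) (N v : Set V))
    (hsymm : ∀ u v, u ∈ N v → v ∈ N u) {M : ℕ} (hM : 0 < M) (hcard : ∀ v, (N v).card ≤ M)
    (hN : ∀ B, MeasurableSet B → MeasurableSet {v | ∃ u ∈ N v, u ∈ B})
    (hbadm : ∀ θ : V → L, Measurable θ → MeasurableSet {v | bad v θ})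
    {s : ℕ} {σ : V → Fin s} (hσ : ∀ i, MeasurableSet (σ ⁻¹' {i}))
    (hfin : ∀ i, ∀ x ∈ σ ⁻¹' {i}, {y | Relation.ReflTransGen (Linked N (σ ⁻¹' {i})) x y}.Finite)
    {c : ℝ} (hc : 0 < c) (hprob : ∀ θ v, resample (N v) (indic (bad v)) θ ≤ c)
    (hlt : (4 * (M : ℝ) ^ 2) ^ s * c < 1) :
    ∃ θ : V → L, Measurable θ ∧ ∀ v, ¬ bad v θ := by
  have hM' : (0 : ℝ) < M := by exact_mod_cast hM
  have hσm : Measurable σ := measurable_to_countable' hσ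
  have key : ∀ i ≤ s, ∃ θ : V → L, Measurable θ ∧
      ∀ v, condProb N bad {x | (σ x : ℕ) < i} θ v ≤ (4 * (M : ℝ) ^ 2) ^ i * c := by
    intro i
    induction i with
    | zero =>
      intro _
      obtain ⟨d⟩ := ‹Nonempty L›
      refine ⟨fun _ => d, measurable_const, fun v => ?_⟩
      simpa [condProb, outside] using hprob (fun _ => d) v
    | succ i ih =>
      intro hi
      obtain ⟨θ, hθ, hcp⟩ := ih (by omega)
      obtain ⟨θ', hθ', hcp'⟩ := exists_measurable_extension hbad hsymm hM hcard hN hbadm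
        (D := {x | (σ x : ℕ) < i}) (U := σ ⁻¹' {⟨i, hi⟩})
        (hσm (Set.to_countable {j : Fin s | (j : ℕ) < i}).measurableSet) (hσ _)
        (fun x (hx : σ x = _) (h : (σ x : ℕ) < i) => by simp [hx] at h)
        (hfin _) hθ (by positivity) hcp
      refine ⟨θ', hθ', fun v => ?_⟩
      rw [pow_succ', mul_assoc]
      refine le_trans (le_of_eq (condProb_congr hbad (fun x _ => ?_) fun _ _ => rfl)) (hcp' v)
      simp only [Set.mem_ofPred_eq, Set.mem_union, Set.mem_preimage, Set.mem_singleton_iff,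
        Fin.ext_iff]
      omega
  obtain ⟨θ, hθ, hcp⟩ := key s le_rfl
  refine ⟨θ, hθ, fun v hv => ?_⟩
  have h := (hcp v).trans_lt hlt
  -- With every label fixed, the conditional probability of an event that occurs is 1, against the
  -- bound below 1.
  have h1 : condProb N bad {x | (σ x : ℕ) < s} θ v = 1 := by
    unfold condProb
    have h0 : outside (N v) {x | (σ x : ℕ) < s} = ∅ := by
      ext x
      simp [mem_outside]
    rw [h0, resample_eq_self (dependsOn_univ _) (by simp)]
    exact if_pos hv
  exact absurd h (by rw [h1]; exact lt_irrefl _)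

end BorelLocalLemma

/-! ### LCL problems on Borel graphs of finite asymptotic separation index -/

section Main

/-- The bound s must precede R: it determines n, hence the running time, hence the scale at which
the separation is used. -/
theorem exists_hasSeparation_of_asi_lt_top {V : Type*} [MeasurableSpace V] {G : SimpleGraph V}
    (h : asi G < ⊤) : ∃ s : ℕ, ∀ R, ∃ s' ≤ s, HasSeparation (power G R) s' := by
  obtain ⟨s, hs⟩ := ENat.ne_top_iff_exists.1 h.ne
  refine ⟨s, fun R => ?_⟩
  have hle : si (power G R) ≤ s := hs ▸ le_iSup (fun R => si (power G R)) R
  have hne : {t : ℕ∞ | ∃ s : ℕ, t = s ∧ HasSeparation (power G R) s}.Nonempty := by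
    by_contra hemp
    rw [Set.not_nonempty_iff_eq_empty] at hemp
    rw [si, hemp, sInf_empty] at hle
    exact absurd hle (by simp)
  obtain ⟨s', hs', hsep⟩ := csInf_mem hne
  refine ⟨s', ?_, hsep⟩
  rw [si, hs'] at hle
  exact_mod_cast hle

theorem randSolvable_of_randComplexity_ne_top {P : LCLProblem.{u}} {C : Set FinStructuredGraph.{u}}
    {n : ℕ} (h : randComplexity P C n ≠ ⊤) : RandSolvable P C n (randComplexity P C n).toNat := by
  have hne : {t : ℕ∞ | ∃ T : ℕ, t = T ∧ RandSolvable P C n T}.Nonempty := by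
    by_contra hemp
    rw [Set.not_nonempty_iff_eq_empty] at hemp
    exact h (by rw [randComplexity, hemp, sInf_empty])
  obtain ⟨T, hT, hsol⟩ := csInf_mem hne
  have : randComplexity P C n = T := hT
  rw [this]
  exact hsol

/-- The logarithm of the left side is c₀ + c₁T, affine in T = o(log n). For large n each summand is
at most half of log n, one strictly less. -/
theorem IsLittleOLog.exists_pow_lt {t : ℕ → ℕ∞} (ht : IsLittleOLog t) (Δ R s : ℕ) :
    ∃ n : ℕ, t n ≠ ⊤ ∧ (4 * (((Δ + 1) ^ ((t n).toNat + R) : ℕ) : ℝ) ^ 2) ^ (s + 1) < n := by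
  set a := Real.log (Δ + 1) with ha
  have ha0 : 0 ≤ a := Real.log_nonneg (by simp)
  set c₁ : ℝ := 2 * (s + 1) * a with hc₁
  have hc₁0 : 0 ≤ c₁ := by positivity
  set c₀ : ℝ := (s + 1) * (Real.log 4 + 2 * R * a) with hc₀
  have h1 := ht.2.def (c := 1 / (2 * (c₁ + 1))) (by positivity)
  have h2 := (Real.tendsto_log_atTop.comp tendsto_natCast_atTop_atTop).eventually_gt_atTop (2 * c₀)
  obtain ⟨n, hn0, hn1, hn2, hnpos⟩ := (ht.1.and (h1.and (h2.and (eventually_gt_atTop 0)))).exists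
  refine ⟨n, hn0, ?_⟩
  have hn' : (0 : ℝ) < n := by exact_mod_cast hnpos
  have hlog0 : 0 ≤ Real.log n := Real.log_natCast_nonneg n
  rw [Real.norm_of_nonneg (Nat.cast_nonneg _), Real.norm_of_nonneg hlog0] at hn1
  set T := (t n).toNat
  simp only [Function.comp_apply] at hn2
  have hT : c₁ * T ≤ Real.log n / 2 := by
    have h3 : c₁ * T ≤ (c₁ + 1) * T := by nlinarith [Nat.cast_nonneg (α := ℝ) T]
    have h4 : (c₁ + 1) * (T : ℝ) ≤ (c₁ + 1) * (1 / (2 * (c₁ + 1)) * Real.log n) :=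
      mul_le_mul_of_nonneg_left hn1 (by positivity)
    have h5 : (c₁ + 1) * (1 / (2 * (c₁ + 1)) * Real.log n) = Real.log n / 2 := by field_simp
    linarith
  have hpos : (0 : ℝ) < ((Δ + 1 : ℝ) ^ (T + R)) := by positivity
  push_cast
  rw [← Real.log_lt_log_iff (by positivity) hn', Real.log_pow, Real.log_mul (by norm_num)
    (by positivity), Real.log_pow, Real.log_pow]
  push_cast
  rw [← ha]
  have h6 : ((s : ℝ) + 1) * (Real.log 4 + 2 * ((T + R) * a)) = c₀ + c₁ * T := by
    rw [hc₀, hc₁]; ring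
  rw [h6]
  linarith

/-- Linked vertices share a ball of radius r, so they are equal or adjacent in the power with
exponent 2r. -/
theorem finite_linked_component {V : Type*} {G : SimpleGraph V} {r : ℕ} {N : V → Finset V}
    (hN : ∀ v u, u ∈ N v ↔ u ∈ ball G v r) {U : Set V}
    (h : ComponentFinite ((power G (r + r)).induce U)) {x : V} (hx : x ∈ U) :
    {y | Relation.ReflTransGen (Linked N U) x y}.Finite := by
  refine ((h (SimpleGraph.connectedComponentMk _ ⟨x, hx⟩)).image Subtype.val).subset ?_
  intro y hy
  change Relation.ReflTransGen (Linked N U) x y at hy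
  induction hy with
  | refl => exact ⟨⟨x, hx⟩, rfl, rfl⟩
  | @tail y z _ hyz ih =>
    obtain ⟨⟨y', hy'⟩, hmem, rfl⟩ := ih
    obtain ⟨_, hz, w, hw, hzw⟩ := hyz
    refine ⟨⟨z, hz⟩, ?_, rfl⟩
    rw [SimpleGraph.ConnectedComponent.mem_supp_iff] at hmem ⊢
    rw [← hmem, SimpleGraph.ConnectedComponent.eq]
    by_cases hne : z = y'
    · subst hne; exact SimpleGraph.Reachable.refl _
    · refine SimpleGraph.Adj.reachable ?_
      refine ⟨hne, mem_ball_comm.1 (mem_ball_trans ((hN _ _).1 hw) ((hN _ _).1 hzw))⟩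

/-! ### Failure events of a LOCAL algorithm -/

variable {V : Type u}

/-- The output of the algorithm on the labeling `θ` violates the constraint at `v`. -/
def Violates (P : LCLProblem.{u}) (A : LocalAlgorithm.{u}) (T : ℕ) (G : StructuredGraph V)
    (hG : LocallyFinite G.graph) {ℓ : ℕ} (v : V) (θ : V → Fin ℓ) : Prop :=
  ¬ P.valid (ballType G hG (A.output T G hG fun u => (θ u : ℕ)) v P.radius)

theorem violates_dependsOn (P : LCLProblem.{u}) (A : LocalAlgorithm.{u}) (T : ℕ)
    (G : StructuredGraph V) (hG : LocallyFinite G.graph) (ℓ : ℕ) (v : V) :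
    DependsOn (Violates P A T G hG (ℓ := ℓ) v) (ball G.graph v (T + P.radius)) := by
  intro θ θ' h
  unfold Violates
  rw [ballType_output_eq_of_embedding (ι := id) hG hG A Function.injective_id
    (fun _ _ => Iff.rfl) (fun _ => rfl) (g := fun u => (θ' u : ℕ)) (by simp)
    fun u hu => by simp [h u hu]]
  rfl

/-- A successful algorithm for the members of a class with `n` vertices violates the constraint at
any given vertex with probability at most `1 / n`. -/
theorem resample_violates_le [DecidableEq V] [Infinite V] {P : LCLProblem.{u}}
    {C : Set FinStructuredGraph.{u}} {G : StructuredGraph V} (hG : LocallyFinite G.graph)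
    (hinduced : ∀ U : Finset V, G.finInduce U ∈ C) {n ℓ T : ℕ} (hℓ : 0 < ℓ) {A : LocalAlgorithm.{u}}
    (hA : ∀ H ∈ C, Nat.card H.carrier = n → 1 - 1 / (n : ℝ) ≤ H.successProb P A T ℓ)
    {v : V} {N : Finset V} (hN : (N : Set V) = ball G.graph v (T + P.radius)) (hcard : N.card ≤ n)
    (θ : V → Fin ℓ) : resample N (indic (Violates P A T G hG v)) θ ≤ 1 / n := by
  have : NeZero ℓ := ⟨hℓ.ne'⟩
  -- The ball is padded to exactly n vertices, which needs `V` infinite. The guarantee for n-vertex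
  -- graphs then applies to the subgraph induced on `U`.
  obtain ⟨U, hNU, hU⟩ := Infinite.exists_superset_card_eq N n hcard
  have hdep := indic_dependsOn (violates_dependsOn P A T G hG ℓ v)
  rw [← hN] at hdep
  rw [resample_eq_of_inter_eq hdep (S' := U) (by simp [Finset.inter_eq_right.2 hNU])]
  have hvU : v ∈ U := hNU (Finset.mem_coe.1 (hN ▸ mem_ball_self _ _ _))
  have hA' := hA _ (hinduced U) (by
    rw [← hU]; exact Nat.card_eq_card_toFinset (U : Set V) |>.trans (by simp))
  classical
  let col : (U → Fin ℓ) → Prop := fun η => P.IsColoring (G.finInduce U).graph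
    (G.finInduce U).locallyFinite (A.output T (G.finInduce U).graph (G.finInduce U).locallyFinite
      fun u => (η u : ℕ))
  have hsucc : (G.finInduce U).successProb P A T ℓ =
      Finset.expect Finset.univ fun η : U → Fin ℓ => if col η then (1 : ℝ) else 0 := by
    rw [Fintype.expect_eq_sum_div_card, Finset.sum_boole, ← Nat.card_eq_fintype_card,
      ← Fintype.card_subtype, ← Nat.card_eq_fintype_card]
    rfl
  -- Success on the induced subgraph and a violation at v in `G` exclude each other, because `U`
  -- contains everything visible from v.
  have hsum : resample U (indic (Violates P A T G hG v)) θ +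
      (G.finInduce U).successProb P A T ℓ ≤ 1 := by
    rw [hsucc]
    unfold resample
    rw [← Finset.expect_add_distrib, ← Fintype.expect_const (ι := U → Fin ℓ) (1 : ℝ)]
    refine Finset.expect_le_expect fun η _ => ?_
    by_cases hcol : col η
    · have hnv : ¬ Violates P A T G hG v (Function.updateFinset θ U η) := by
        have hloc : LocallyFinite (G.induce (U : Set V)).graph := (G.finInduce U).locallyFinite
        have h : ballType (G.induce (U : Set V)) hloc (A.output T (G.induce (U : Set V)) hloc
              fun u => (η u : ℕ)) ⟨v, hvU⟩ P.radius =
            ballType G hG (A.output T G hG fun u => (Function.updateFinset θ U η u : ℕ)) v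
              P.radius := by
          refine ballType_output_eq_of_embedding (ι := Subtype.val) hloc hG A
            Subtype.val_injective (fun _ _ => Iff.rfl) (fun _ => rfl) ?_ ?_
          · rw [← hN]
            intro u hu
            exact ⟨⟨u, hNU hu⟩, rfl⟩
          · rintro ⟨u, hu⟩ _
            exact congrArg Fin.val (updateFinset_eq_of_mem hu)
        exact not_not.2 (h ▸ hcol ⟨v, hvU⟩)
      simp [indic, hnv, hcol]
    · simp only [hcol, if_false, add_zero]
      unfold indic
      split_ifs <;> norm_num
  linarith

variable [MeasurableSpace V] [StandardBorelSpace V]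

theorem measurable_output {G : StructuredGraph V} (hB : G.IsBorel)
    (hdeg : FiniteMaxDegree G.graph) (hG : LocallyFinite G.graph) (A : LocalAlgorithm.{u}) (T : ℕ)
    {f : V → ℕ} (hf : Measurable f) : Measurable (A.output T G hG f) :=
  measurable_to_countable' fun k => measurableSet_ballType hB hdeg hG hf T {τ | A τ = k}

/-- Here balls cannot be padded to n vertices, but `G` is itself, up to isomorphism, a colorable
member of the class, and every function is Borel. -/
theorem exists_measurable_coloring_of_finite [Finite V] {P : LCLProblem.{u}}
    {C : Set FinStructuredGraph.{u}} (hcolorable : ∀ H ∈ C, H.IsColorable P)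
    {G : StructuredGraph V} (hG : LocallyFinite G.graph)
    (hinduced : ∀ U : Finset V, G.finInduce U ∈ C) :
    ∃ f : V → ℕ, Measurable f ∧ P.IsColoring G hG f := by
  have := Fintype.ofFinite V
  obtain ⟨f, hf⟩ := hcolorable _ (hinduced Finset.univ)
  refine ⟨fun v => f ⟨v, Finset.mem_coe.2 (Finset.mem_univ v)⟩, measurable_of_countable _,
    fun v => ?_⟩
  have h : ballType (G.induce ((Finset.univ : Finset V) : Set V))
      (G.finInduce Finset.univ).locallyFinite f ⟨v, Finset.mem_coe.2 (Finset.mem_univ v)⟩ P.radius =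
      ballType G hG (fun v => f ⟨v, Finset.mem_coe.2 (Finset.mem_univ v)⟩) v P.radius :=
    ballType_eq_of_embedding (ι := Subtype.val) _ hG Subtype.val_injective
      (fun _ _ => Iff.rfl) (fun _ => rfl)
      (fun u _ => ⟨⟨u, Finset.mem_coe.2 (Finset.mem_univ u)⟩, rfl⟩) (fun _ _ => rfl)
  exact h ▸ hf ⟨v, Finset.mem_coe.2 (Finset.mem_univ v)⟩

end Main

end BorelLCL

open BorelLCL
theorem theorem1p24 {V : Type u} [MeasurableSpace V] [StandardBorelSpace V]
    (P : LCLProblem.{u}) (C : Set FinStructuredGraph.{u})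
    (hcolorable : ∀ H ∈ C, H.IsColorable P)
    (hrand : IsLittleOLog (randComplexity P C))
    (G : StructuredGraph V) (hBorel : G.IsBorel) (hdeg : FiniteMaxDegree G.graph)
    (hinduced : ∀ U : Finset V, G.finInduce U ∈ C)
    (hasi : asi G.graph < ⊤) :
    ∃ f : V → ℕ, Measurable f ∧ P.IsColoring G hdeg.locallyFinite f := by
  classical
  have hG := hdeg.locallyFinite
  rcases finite_or_infinite V with hfinite | hinfinite
  · exact exists_measurable_coloring_of_finite hcolorable hG hinduced
  obtain ⟨Δ, hΔ⟩ := id hdeg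
  obtain ⟨s, hs⟩ := exists_hasSeparation_of_asi_lt_top hasi
  obtain ⟨n, htop, hn⟩ := hrand.exists_pow_lt Δ P.radius s
  obtain ⟨ℓ, hℓ, A, hA⟩ := randSolvable_of_randComplexity_ne_top htop
  generalize (randComplexity P C n).toNat = T at hn hA
  set M := (Δ + 1) ^ (T + P.radius) with hM
  have hM0 : 0 < M := by positivity
  have hM1 : (1 : ℝ) ≤ M := by exact_mod_cast hM0
  have h4M : (M : ℝ) ≤ 4 * (M : ℝ) ^ 2 := by nlinarith
  have hn0 : (0 : ℝ) < n := lt_of_le_of_lt (by positivity) hn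
  have hMn : M ≤ n := by
    have h1 : 4 * (M : ℝ) ^ 2 ≤ (4 * (M : ℝ) ^ 2) ^ (s + 1) :=
      le_self_pow₀ (hM1.trans h4M) (Nat.succ_ne_zero s)
    exact_mod_cast (h4M.trans (h1.trans hn.le))
  have : NeZero ℓ := ⟨hℓ.ne'⟩
  let N : V → Finset V := fun v => (ball_finite hG v (T + P.radius)).toFinset
  have hN : ∀ v u, u ∈ N v ↔ u ∈ ball G.graph v (T + P.radius) := fun v u => by simp [N]
  have hNcoe : ∀ v, (N v : Set V) = ball G.graph v (T + P.radius) := fun v => by simp [N]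
  have hcard : ∀ v, (N v).card ≤ M := by
    intro v
    have h := encard_ball_le hΔ v (T + P.radius)
    rw [← hNcoe, Set.encard_coe_eq_coe_finsetCard] at h
    exact_mod_cast h
  have hout : ∀ θ : V → Fin ℓ, Measurable θ →
      Measurable (A.output T G hG fun u => (θ u : ℕ)) := fun θ hθ =>
    measurable_output hBorel hdeg hG A T (measurable_from_top.comp hθ)
  -- Twice the radius T + R of the failure events, so that no event sees two components. There are
  -- s' + 1 ≤ s + 1 parts, matching the exponent in `hn`.
  obtain ⟨s', hs', σ, hσ, hσfin⟩ := hs (T + P.radius + (T + P.radius))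
  obtain ⟨θ, hθ, hgood⟩ := exists_measurable_avoiding (N := N) (bad := Violates P A T G hG (ℓ := ℓ))
    (fun v => hNcoe v ▸ violates_dependsOn P A T G hG ℓ v)
    (fun u v h => (hN _ _).2 (mem_ball_comm.1 ((hN _ _).1 h))) hM0 hcard
    (fun B hB => by
      simpa only [hN] using measurableSet_exists_mem_ball hBorel.1 hdeg (T + P.radius) hB)
    (fun θ hθ => measurableSet_ballType hBorel hdeg hG (hout θ hθ) P.radius {τ | ¬ P.valid τ})
    hσ (fun i x hx => finite_linked_component hN (hσfin i) hx)
    (c := 1 / (n : ℝ)) (by positivity)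
    (fun θ v => resample_violates_le hG hinduced hℓ hA (hNcoe v) ((hcard v).trans hMn) θ)
    (by
      rw [mul_one_div, div_lt_one hn0]
      exact (pow_le_pow_right₀ (hM1.trans h4M) (by omega)).trans_lt hn)
  exact ⟨_, hout θ hθ, fun v => not_not.1 (hgood v)⟩
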